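/- **Setting.** Fix numbers $T,K,p,q,d$. An individual makes $T$ choices among $K$ alternatives, with regressors $X_{tk}\in\mathbb R^p$, $\tilde X_{tk}\in\mathbb R^q$. In the panel multinomial probit (MNP) model with parameter $\theta\in\mathbb R^d$ the utilities are $U_{tk}=X_{tk}'\beta(\theta)+\tilde X_{tk}'\alpha+e_{tk}$, where $\alpha\sim N(0,\Omega(\theta))$ and $e_{t\cdot}\sim N(0,\Sigma(\theta))$, $t=1,\dots,T$, are independent of each other and of the regressors, and at occasion $t$ an alternative of maximal utility is chosen. An observation is $Z=(Y,X,\tilde X)$ with $Y_t$ the choice at occasion $t$. The pairwise composite log-likelihood of one individual is $$lcml(\theta;Z)=\sum_{t<t'}\log \mathbb P_\theta(C_t=Y_t,\,C_{t'}=Y_{t'}\mid X,\tilde X).$$ The Solow--Joe (SJ) approximation of a Gaussian distribution function with correlation matrix $R$ is $$\Phi_D(b;0,R)\approx\Phi_2(b_1,b_2;R_{12})\prod_{j=3}^{D}\Big(\Phi(b_j)+q_j'Q_j^{-1}\,[\,1-\Phi(b_i)\,]_{i<j}\Big),\qquad Q_j=[\mathrm{Cov}(I_i,I_l)]_{i,l<j},\quad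 q_j=[\mathrm{Cov}(I_j,I_i)]_{i<j},$$ where $I_i=\mathbb 1\{u_i\le b_i\}$ and $u\sim N(0,R)$; it is averaged over a fixed finite nonempty family of orderings of the coordinates. It is applied to MNP choice probabilities written as Gaussian distribution functions of the standardised utility differences. The model implied by the SJ approximation has as conditional choice probabilities given the regressors (of the whole sequence of choices or, alternatively, of every pair of choices) the approximated probabilities, normalised to sum to one over all choice patterns. **Assumptions.** Let $\Theta\subset\mathbb R^d$ be compact and $\theta_0$ an interior point of $\Theta$. Let $\beta,\Omega,\Sigma$ be three times continuously differentiable in the interior of $\Theta$ and, for all $\theta\in\Theta$, let $\Omega(\theta)$ be positive semidefinite and $\Sigma(\theta)$ positive definite with $\|\Sigma(\theta)^{-1}\|\le M_\Sigma$. Let the regressors be random with $\|X_{tk}\|\le M_X$ and $\|\tilde X_{tk}\|\le\tilde M_X$ almost surely. **Theorem.** Suppose that $Z$ is generated by the MNP model with parameter $\theta_0$. Then the following regularity conditions hold for $lcml$: 1. there is a neighbourhood of $\theta_0$ on which $\theta\mapsto lcml(\theta;Z)$ is, almost surely, three times continuously differentiable, and on which all derivatives up to order three are dominated by functions of $Z$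 with finite mean under $\theta_0$; 2. the score $\partial_\theta\, lcml(\theta_0;Z)$ has finite fourth moments under $\theta_0$. Suppose instead that $Z$ is generated by the model implied by the SJ approximation with parameter $\theta_0$, and that at $\theta_0$ the approximated probabilities of all choices at all pairs of occasions are positive for all regressors in the support of their law. Then the same conditions 1 and 2 hold for the pairwise composite log-likelihood formed with the SJ-approximated pair probabilities, both unnormalised and normalised to sum to one. -/

import Mathlib

open MeasureTheory ProbabilityTheory
open scoped Topology Matrix

noncomputable section

namespace PanelProbit

/-! ### Data of one decision maker -/

/-- Regressors of one individual: the vectors `X t k` (first component, entering with the fixed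
coefficients) and `X̃ t k` (second component, entering with the random coefficients), for the
choice occasions `t : Fin T` and the alternatives `k : Fin K`. -/
abbrev Regressors (T K p q : ℕ) : Type :=
  (Fin T → Fin K → EuclideanSpace ℝ (Fin p)) × (Fin T → Fin K → EuclideanSpace ℝ (Fin q))

/-- One observation: the sequence of chosen alternatives together with the regressors. -/
abbrev Observation (T K p q : ℕ) : Type := (Fin T → Fin K) × Regressors T K p q

/-- The choices at the occasions in `A`. -/
abbrev choicesOn {T K : ℕ} (A : Finset (Fin T)) (y : Fin T → Fin K) : A → Fin K := fun t => y t

/-! ### The multinomial probit model -/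

/-- A parametrisation, by `θ ∈ ℝ^d`, of the fixed coefficients `β`, of the covariance matrix `Ω` of
the random coefficients and of the covariance matrix `Σ` of the errors. -/
structure Param (K p q d : ℕ) where
  beta : EuclideanSpace ℝ (Fin d) → EuclideanSpace ℝ (Fin p)
  Omega : EuclideanSpace ℝ (Fin d) → Matrix (Fin q) (Fin q) ℝ
  Sigma : EuclideanSpace ℝ (Fin d) → Matrix (Fin K) (Fin K) ℝ

/-- The random utility `U t k = X t k · b + X̃ t k · a + e t k`. -/
def utility {T K p q : ℕ} (b : EuclideanSpace ℝ (Fin p)) (x : Regressors T K p q)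
    (w : EuclideanSpace ℝ (Fin q) × (Fin T → EuclideanSpace ℝ (Fin K)))
    (t : Fin T) (k : Fin K) : ℝ :=
  inner ℝ (x.1 t k) b + inner ℝ (x.2 t k) w.1 + w.2 t k

variable {T K p q d : ℕ}

/-- Joint law of the random coefficients `α ~ N(0, Ω)` and of the errors `e t ~ N(0, Σ)`, which are
independent over `t` and independent of `α`. -/
def noiseLaw (T : ℕ) (m : Param K p q d) (θ : EuclideanSpace ℝ (Fin d)) :
    Measure (EuclideanSpace ℝ (Fin q) × (Fin T → EuclideanSpace ℝ (Fin K))) :=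
  (multivariateGaussian 0 (m.Omega θ)).prod
    (Measure.pi fun _ : Fin T => multivariateGaussian 0 (m.Sigma θ))

/-- Probit probability, given the regressors `x`, that for each occasion `t ∈ A` the alternative
`y t` has maximal utility. -/
def mnpProb (m : Param K p q d) (θ : EuclideanSpace ℝ (Fin d)) (A : Finset (Fin T))
    (y : A → Fin K) (x : Regressors T K p q) : ℝ :=
  (noiseLaw T m θ).real
    {w | ∀ t : A, ∀ k : Fin K, utility (m.beta θ) x w t k ≤ utility (m.beta θ) x w t (y t)}

/-! ### The Solow-Joe approximation -/

/-- The indicator `I_i = 1{u_i ≤ b_i}`. -/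
def ind {D : ℕ} (b : Fin D → ℝ) (i : Fin D) (u : EuclideanSpace ℝ (Fin D)) : ℝ :=
  Set.indicator {v : EuclideanSpace ℝ (Fin D) | v i ≤ b i} (fun _ => 1) u

/-- `Cov(I_i, I_j)` under `N(0, R)`. -/
def indCov {D : ℕ} (b : Fin D → ℝ) (R : Matrix (Fin D) (Fin D) ℝ) (i j : Fin D) : ℝ :=
  covariance (ind b i) (ind b j) (multivariateGaussian 0 R)

/-- The standard normal distribution function. -/
def stdNormalCDF (s : ℝ) : ℝ := cdf (gaussianReal 0 1) s

/-- The linear projection `Φ(b_j) + q' Q⁻¹ [1 - Φ(b_i)]_{i < j}` replacing the conditional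
probability of `I_j = 1` given `I_i = 1` for all `i < j`. -/
def sjFactor {D : ℕ} (b : Fin D → ℝ) (R : Matrix (Fin D) (Fin D) ℝ) (j : Fin D) : ℝ :=
  let Q : Matrix {i : Fin D // i < j} {i : Fin D // i < j} ℝ :=
    Matrix.of fun i l => indCov b R i l
  let r : {i : Fin D // i < j} → ℝ := fun i => indCov b R j i
  stdNormalCDF (b j) + r ⬝ᵥ (Q⁻¹ *ᵥ fun i => 1 - stdNormalCDF (b i))

/-- The Solow-Joe approximation of the Gaussian distribution function `Φ_D(b; 0, R)`, for a
correlation matrix `R`: the exact probability for the first two coordinates, times the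
linear projections for the other ones. -/
def sjCDF {D : ℕ} (b : Fin D → ℝ) (R : Matrix (Fin D) (Fin D) ℝ) : ℝ :=
  (multivariateGaussian 0 R).real {u | ∀ i : Fin D, (i : ℕ) < 2 → u i ≤ b i} *
    ∏ j ∈ Finset.univ.filter (fun j : Fin D => 2 ≤ (j : ℕ)), sjFactor b R j

/-- Index set of the utility differences `U t k - U t (y t)`, `t ∈ A`, `k ≠ y t`. -/
abbrev DiffIdx (A : Finset (Fin T)) (y : A → Fin K) : Type :=
  {i : A × Fin K // i.2 ≠ y i.1}

/-- `- E (U t k - U t (y t))`: the upper limit for the centred utility difference. -/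
def diffLimit (m : Param K p q d) (θ : EuclideanSpace ℝ (Fin d)) (A : Finset (Fin T))
    (y : A → Fin K) (x : Regressors T K p q) (i : DiffIdx A y) : ℝ :=
  inner ℝ (x.1 i.1.1 (y i.1.1) - x.1 i.1.1 i.1.2) (m.beta θ)

/-- Covariance of the utility differences `U t k - U t (y t)` and `U s l - U s (y s)`. -/
def diffCov (m : Param K p q d) (θ : EuclideanSpace ℝ (Fin d)) (A : Finset (Fin T))
    (y : A → Fin K) (x : Regressors T K p q) : Matrix (DiffIdx A y) (DiffIdx A y) ℝ :=
  Matrix.of fun i j =>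
    (x.2 i.1.1 i.1.2 - x.2 i.1.1 (y i.1.1)).ofLp ⬝ᵥ
        (m.Omega θ *ᵥ (x.2 j.1.1 j.1.2 - x.2 j.1.1 (y j.1.1)).ofLp) +
      if i.1.1 = j.1.1 then
        m.Sigma θ i.1.2 j.1.2 - m.Sigma θ i.1.2 (y j.1.1) - m.Sigma θ (y i.1.1) j.1.2
          + m.Sigma θ (y i.1.1) (y j.1.1)
      else 0

/-- The standardised upper limits `b`. -/
def limits (m : Param K p q d) (θ : EuclideanSpace ℝ (Fin d)) (A : Finset (Fin T))
    (y : A → Fin K) (x : Regressors T K p q) (i : DiffIdx A y) : ℝ :=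
  diffLimit m θ A y x i / √(diffCov m θ A y x i i)

/-- The correlation matrix `R` of the utility differences. -/
def corr (m : Param K p q d) (θ : EuclideanSpace ℝ (Fin d)) (A : Finset (Fin T))
    (y : A → Fin K) (x : Regressors T K p q) : Matrix (DiffIdx A y) (DiffIdx A y) ℝ :=
  Matrix.of fun i j =>
    diffCov m θ A y x i j / (√(diffCov m θ A y x i i) * √(diffCov m θ A y x j j))

/-- The orderings of the coordinates over which the approximation is averaged: for every set of
occasions and every choice pattern a nonempty finite set of enumerations. -/
structure Orderings (T K : ℕ) where
  set : ∀ (A : Finset (Fin T)) (y : A → Fin K),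
    Finset (Fin (Fintype.card (DiffIdx A y)) ≃ DiffIdx A y)
  nonempty : ∀ A y, (set A y).Nonempty

/-- The Solow-Joe approximation of `mnpProb`, averaged over the selected orderings. -/
def sjProb (m : Param K p q d) (o : Orderings T K) (θ : EuclideanSpace ℝ (Fin d))
    (A : Finset (Fin T)) (y : A → Fin K) (x : Regressors T K p q) : ℝ :=
  (∑ σ ∈ o.set A y,
      sjCDF (fun i => limits m θ A y x (σ i)) ((corr m θ A y x).submatrix σ σ)) /
    (o.set A y).card

/-- The approximated choice probabilities, normalised to sum to one. -/
def sjProbNormalized (m : Param K p q d) (o : Orderings T K) (θ : EuclideanSpace ℝ (Fin d))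
    (A : Finset (Fin T)) (y : A → Fin K) (x : Regressors T K p q) : ℝ :=
  sjProb m o θ A y x / ∑ y' : A → Fin K, sjProb m o θ A y' x

/-! ### Laws of the data, pairwise likelihood, regularity conditions -/

/-- Under `P`, the conditional probabilities, given the regressors, of the choices at the occasions
in `A` are given by `π`. -/
def HasChoiceProb (P : Measure (Observation T K p q)) (A : Finset (Fin T))
    (π : (A → Fin K) → Regressors T K p q → ℝ) : Prop :=
  ∀ (y : A → Fin K) (B : Set (Regressors T K p q)), MeasurableSet B →
    P {z | choicesOn A z.1 = y ∧ z.2 ∈ B} =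
      ∫⁻ x in B, ENNReal.ofReal (π y x) ∂(P.map Prod.snd)

/-- The data are generated by the multinomial probit model with parameter `θ`. -/
def GeneratedByMNP (m : Param K p q d) (θ : EuclideanSpace ℝ (Fin d))
    (P : Measure (Observation T K p q)) : Prop :=
  HasChoiceProb P Finset.univ (mnpProb m θ Finset.univ)

/-- The data are generated by a model implied by the Solow-Joe approximation with parameter `θ`:
the normalised approximated probabilities are the conditional choice probabilities, either of
the whole sequence of choices, or of each pair of choices. -/
def GeneratedBySJ (m : Param K p q d) (o : Orderings T K) (θ : EuclideanSpace ℝ (Fin d))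
    (P : Measure (Observation T K p q)) : Prop :=
  HasChoiceProb P Finset.univ (sjProbNormalized m o θ Finset.univ) ∨
    ∀ t t' : Fin T, t < t' → HasChoiceProb P {t, t'} (sjProbNormalized m o θ {t, t'})

/-- The pairwise composite marginal log-likelihood of one observation, for given choice
probabilities `π θ A y x`. -/
def lcml (π : EuclideanSpace ℝ (Fin d) → (A : Finset (Fin T)) → (A → Fin K) →
      Regressors T K p q → ℝ)
    (z : Observation T K p q) (θ : EuclideanSpace ℝ (Fin d)) : ℝ :=
  ∑ t : Fin T, ∑ t' ∈ Finset.Ioi t,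
    Real.log (π θ {t, t'} (choicesOn {t, t'} z.1) z.2)

/-- The regularity conditions at `θ₀` on a log-likelihood contribution `l z θ` under the data law
`P`: on a neighbourhood of `θ₀` it is three times continuously differentiable and all derivatives
up to order three are dominated by functions with finite mean, and the score at `θ₀` has finite
fourth moments. -/
structure ScoreConditions (P : Measure (Observation T K p q))
    (l : Observation T K p q → EuclideanSpace ℝ (Fin d) → ℝ)
    (θ₀ : EuclideanSpace ℝ (Fin d)) : Prop where
  smooth_dominated : ∃ V : Set (EuclideanSpace ℝ (Fin d)), IsOpen V ∧ θ₀ ∈ V ∧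
    (∀ᵐ z ∂P, ContDiffOn ℝ 3 (l z) V) ∧
    ∀ k ≤ 3, ∃ g : Observation T K p q → ℝ, Integrable g P ∧
      ∀ᵐ z ∂P, ∀ θ ∈ V, ‖iteratedFDeriv ℝ k (l z) θ‖ ≤ g z
  score_moment : MemLp (fun z => gradient (l z) θ₀) 4 P

end PanelProbit

end

/-!
A Gaussian probability of an orthant is a ratio of Laplace transforms of exponentials of a
quadratic form and a shift, hence analytic in the precision matrix and in the limits, and positive
because a nonsingular Gaussian law charges every nonempty open set. The same remark makes the
indicators `1{u_i ≤ b_i}` affinely independent modulo null sets, so that their covariance matrix is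
invertible and the linear projections in the Solow-Joe approximation depend smoothly on the limits
and the correlations. The utility differences of a probit model have a nonsingular Gaussian law,
since the error of a rejected alternative enters no other difference. All choice probabilities are
therefore jointly smooth in the parameter and the regressors; as bounded regressors stay in a
compact set, the logarithms of positive probabilities have uniformly bounded derivatives near the
true parameter.
-/

namespace PanelProbit

section LaplaceTransform

variable {V Ξ : Type*} [MeasurableSpace V] {μ : Measure V} [NormedAddCommGroup Ξ] [NormedSpace ℝ Ξ]

theorem analyticAt_integral {F : Type*} [NormedAddCommGroup F] [NormedSpace ℝ F] [CompleteSpace F]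
    {f : V → Ξ → F} {q : V → FormalMultilinearSeries ℝ Ξ F} {ξ₀ : Ξ} {r : NNReal} (hr : 0 < r)
    (hf : ∀ᵐ v ∂μ, ∀ y, ‖y‖ < r → HasSum (fun n => q v n fun _ => y) (f v (ξ₀ + y)))
    (hq : ∀ n, AEStronglyMeasurable (fun v => q v n) μ) {bound : ℕ → V → ℝ} {B : V → ℝ}
    (hbound : ∀ n, ∀ᵐ v ∂μ, ‖q v n‖ * (r : ℝ) ^ n ≤ bound n v)
    (hsum : ∀ᵐ v ∂μ, HasSum (fun n => bound n v) (B v)) (hint : Integrable B μ) :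
    AnalyticAt ℝ (fun ξ => ∫ v, f v ξ ∂μ) ξ₀ := by
  have hle (n : ℕ) : ∀ᵐ v ∂μ, ‖q v n‖ * (r : ℝ) ^ n ≤ B v := by
    filter_upwards [hsum, ae_all_iff.2 hbound] with v hv hle
    exact (hle n).trans (le_hasSum hv n fun k _ => (by positivity : (0 : ℝ) ≤ _).trans (hle k))
  have hqr (n : ℕ) : Integrable (fun v => ‖q v n‖ * (r : ℝ) ^ n) μ :=
    hint.mono' ((hq n).norm.mul_const _)
      ((hle n).mono fun v hv => by rwa [Real.norm_of_nonneg (by positivity)])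
  have hqint (n : ℕ) : Integrable (fun v => q v n) μ := by
    have h := (hqr n).mul_const ((r : ℝ) ^ n)⁻¹
    simp only [mul_assoc, mul_inv_cancel₀ (pow_ne_zero n (NNReal.coe_pos.2 hr).ne'), mul_one] at h
    exact (integrable_norm_iff (hq n)).1 h
  have hradius : (r : ENNReal) ≤ FormalMultilinearSeries.radius fun n => ∫ v, q v n ∂μ :=
    FormalMultilinearSeries.le_radius_of_bound _ (∫ v, B v ∂μ) fun n =>
      calc ‖∫ v, q v n ∂μ‖ * (r : ℝ) ^ n ≤ (∫ v, ‖q v n‖ ∂μ) * (r : ℝ) ^ n := by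
            gcongr
            exact norm_integral_le_integral_norm _
        _ = ∫ v, ‖q v n‖ * (r : ℝ) ^ n ∂μ := (integral_mul_const _ _).symm
        _ ≤ ∫ v, B v ∂μ := integral_mono_ae (hqr n) hint (hle n)
  refine HasFPowerSeriesOnBall.analyticAt ⟨hradius, ENNReal.coe_pos.2 hr, fun {y} hy => ?_⟩
  have hyr : ‖y‖ < r := by simpa using hy
  simp only [ContinuousMultilinearMap.integral_apply (hqint _)]
  refine hasSum_integral_of_dominated_convergence bound
    (fun n => (ContinuousMultilinearMap.apply ℝ (fun _ : Fin n => Ξ) F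
      fun _ => y).continuous.comp_aestronglyMeasurable (hq n))
    (fun n => (hbound n).mono fun v hv => ((q v n).le_opNorm _).trans (le_trans ?_ hv))
    (hsum.mono fun v hv => hv.summable)
    (hint.congr (hsum.mono fun v hv => hv.tsum_eq.symm)) (hf.mono fun v hv => hv y hyr)
  rw [Fin.prod_const]
  gcongr

/-- The power series of `ξ ↦ exp (L ξ)` at `ξ₀`, for a continuous linear functional `L`. -/
noncomputable def expDualSeries (L : StrongDual ℝ Ξ) (ξ₀ : Ξ) : FormalMultilinearSeries ℝ Ξ ℝ :=
  fun n => Real.exp (L ξ₀) • (NormedSpace.expSeries ℝ ℝ).compContinuousLinearMap L n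

theorem norm_expDualSeries_le (L : StrongDual ℝ Ξ) (ξ₀ : Ξ) (n : ℕ) :
    ‖expDualSeries L ξ₀ n‖ ≤ Real.exp (L ξ₀) * (‖L‖ ^ n / n.factorial) := by
  rw [expDualSeries, norm_smul, Real.norm_of_nonneg (Real.exp_pos _).le, div_eq_inv_mul]
  gcongr
  refine (FormalMultilinearSeries.norm_compContinuousLinearMap_le _ _ _).trans_eq ?_
  rw [NormedSpace.expSeries, norm_smul, ContinuousMultilinearMap.norm_mkPiAlgebraFin, mul_one,
    norm_inv, RCLike.norm_natCast]

theorem hasSum_expDualSeries (L : StrongDual ℝ Ξ) (ξ₀ y : Ξ) :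
    HasSum (fun n => expDualSeries L ξ₀ n fun _ => y) (Real.exp (L (ξ₀ + y))) := by
  rw [map_add, Real.exp_add, congrFun Real.exp_eq_exp_ℝ (L y)]
  exact (NormedSpace.expSeries_hasSum_exp (𝕂 := ℝ) (L y)).mul_left _

theorem continuous_expDualSeries (ξ₀ : Ξ) (n : ℕ) :
    Continuous fun L : StrongDual ℝ Ξ => expDualSeries L ξ₀ n := by
  have hcomp : Continuous fun L : StrongDual ℝ Ξ =>
      (NormedSpace.expSeries ℝ ℝ).compContinuousLinearMap L n :=
    (continuous_eval_const (F := ContinuousMultilinearMap ℝ (fun _ : Fin n => ℝ) ℝ →L[ℝ] _) _).comp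
      ((ContinuousMultilinearMap.compContinuousLinearMapContinuousMultilinear ℝ
        (fun _ : Fin n => Ξ) (fun _ => ℝ) ℝ).cont.comp (continuous_pi fun _ => continuous_id))
  exact (Real.continuous_exp.comp (continuous_eval_const ξ₀)).smul hcomp

theorem analyticAt_integral_exp_dual {S : V → StrongDual ℝ Ξ} {ξ₀ : Ξ} {ε : ℝ} (hε : 0 < ε)
    (hS : AEStronglyMeasurable S μ) {f : V → ℝ} (hle : ∀ᵐ v ∂μ, S v ξ₀ + ε * ‖S v‖ ≤ f v)
    (hint : Integrable (fun v => Real.exp (f v)) μ) :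
    AnalyticAt ℝ (fun ξ => ∫ v, Real.exp (S v ξ) ∂μ) ξ₀ := by
  have hexp : Integrable (fun v => Real.exp (S v ξ₀ + ε * ‖S v‖)) μ := by
    have hcont : Continuous fun L : StrongDual ℝ Ξ => Real.exp (L ξ₀ + ε * ‖L‖) :=
      Real.continuous_exp.comp ((continuous_eval_const ξ₀).add (continuous_norm.const_mul ε))
    refine hint.mono' (hcont.comp_aestronglyMeasurable hS) (hle.mono fun v hv => ?_)
    rwa [Real.norm_of_nonneg (Real.exp_pos _).le, Real.exp_le_exp]
  lift ε to NNReal using hε.le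
  have hsum (v : V) : HasSum (fun n : ℕ => Real.exp (S v ξ₀) * ((ε * ‖S v‖) ^ n / n.factorial))
      (Real.exp (S v ξ₀ + ε * ‖S v‖)) := by
    rw [Real.exp_add, congrFun Real.exp_eq_exp_ℝ (ε * ‖S v‖)]
    exact (NormedSpace.expSeries_div_hasSum_exp (ε * ‖S v‖)).mul_left _
  refine analyticAt_integral (NNReal.coe_pos.1 hε)
    (.of_forall fun v y _ => hasSum_expDualSeries _ _ _)
    (fun n => (continuous_expDualSeries ξ₀ n).comp_aestronglyMeasurable hS)
    (fun n => .of_forall fun v => ?_) (.of_forall hsum) hexp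
  grw [norm_expDualSeries_le]
  exact le_of_eq (by ring)

end LaplaceTransform

section QuadraticExponential

variable {E : Type*} [NormedAddCommGroup E] [InnerProductSpace ℝ E]

/-- The functional `(A, c) ↦ -⟪v, A v⟫ / 2 - ⟪v, c⟫`, which is the exponent of an unnormalised
Gaussian density at `v` as a function of its natural parameters. -/
noncomputable def gaussianStat (v : E) : StrongDual ℝ ((E →L[ℝ] E) × E) :=
  (-(1 / 2 : ℝ) • (innerSL ℝ v ∘L ContinuousLinearMap.apply ℝ E v)).coprod (-innerSL ℝ v)

theorem gaussianStat_apply (v : E) (ξ : (E →L[ℝ] E) × E) :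
    gaussianStat v ξ = -inner ℝ v (ξ.1 v) / 2 - inner ℝ v ξ.2 := by
  simp [gaussianStat]
  ring

theorem gaussianStat_one_zero (v : E) : gaussianStat v (1, 0) = -(1 / 2 * ‖v‖ ^ 2) := by
  rw [gaussianStat_apply, one_apply_eq_self, real_inner_self_eq_norm_sq, inner_zero_right]
  ring

theorem continuous_gaussianStat : Continuous (gaussianStat (E := E)) := by
  have hquad : Continuous fun v : E =>
      -(1 / 2 : ℝ) • (innerSL ℝ v ∘L ContinuousLinearMap.apply ℝ E v) := by fun_prop
  exact (ContinuousLinearMap.coprodEquivL ℝ).continuous.comp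
    (hquad.prodMk (innerSL ℝ (E := E)).continuous.neg)

theorem continuous_exp_gaussianStat (ξ : (E →L[ℝ] E) × E) :
    Continuous fun v => Real.exp (gaussianStat v ξ) :=
  Real.continuous_exp.comp ((continuous_eval_const ξ).comp continuous_gaussianStat)

theorem norm_gaussianStat_le (v : E) : ‖gaussianStat v‖ ≤ ‖v‖ ^ 2 / 2 + ‖v‖ := by
  refine ContinuousLinearMap.opNorm_le_bound _ (by positivity) fun ξ => ?_
  rw [gaussianStat_apply, neg_div, ← neg_add', norm_neg]
  calc ‖inner ℝ v (ξ.1 v) / 2 + inner ℝ v ξ.2‖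
      ≤ ‖inner ℝ v (ξ.1 v)‖ / 2 + ‖inner ℝ v ξ.2‖ := by
        grw [norm_add_le, norm_div, Real.norm_ofNat]
    _ ≤ ‖v‖ * (‖ξ.1‖ * ‖v‖) / 2 + ‖v‖ * ‖ξ.2‖ := by
        grw [norm_inner_le_norm, norm_inner_le_norm, ξ.1.le_opNorm]
    _ ≤ ‖v‖ * (‖ξ‖ * ‖v‖) / 2 + ‖v‖ * ‖ξ‖ := by
        grw [norm_fst_le, norm_snd_le]
    _ = (‖v‖ ^ 2 / 2 + ‖v‖) * ‖ξ‖ := by ring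

theorem gaussianStat_add_mul_norm_le {A : E →L[ℝ] E} (c : E) {a : ℝ} (ha : 0 < a)
    (hA : ∀ v, a * ‖v‖ ^ 2 ≤ inner ℝ v (A v)) (v : E) :
    gaussianStat v (A, c) + a / 4 * ‖gaussianStat v‖ ≤
      (‖c‖ + a / 4) ^ 2 / a + -(a / 8 * ‖v‖ ^ 2) := by
  set b := ‖c‖ + a / 4 with hb
  have hsq : b * ‖v‖ ≤ a / 4 * ‖v‖ ^ 2 + b ^ 2 / a := by
    have : 0 ≤ (a * ‖v‖ - 2 * b) ^ 2 / (4 * a) := by positivity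
    have : a / 4 * ‖v‖ ^ 2 + b ^ 2 / a - b * ‖v‖ = (a * ‖v‖ - 2 * b) ^ 2 / (4 * a) := by
      field_simp
      ring
    linarith
  calc gaussianStat v (A, c) + a / 4 * ‖gaussianStat v‖
      ≤ -(a * ‖v‖ ^ 2) / 2 + ‖v‖ * ‖c‖ + a / 4 * (‖v‖ ^ 2 / 2 + ‖v‖) := by
        have := (neg_le_abs _).trans (abs_real_inner_le_norm v c)
        grw [gaussianStat_apply, norm_gaussianStat_le, ← hA v]
        linarith
    _ = -(3 / 8 * a * ‖v‖ ^ 2) + b * ‖v‖ := by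
        rw [hb]
        ring
    _ ≤ b ^ 2 / a + -(a / 8 * ‖v‖ ^ 2) := by linarith

variable [FiniteDimensional ℝ E]

theorem exists_pos_mul_sq_norm_le_inner {A : E →L[ℝ] E} (hA : ∀ v ≠ 0, 0 < inner ℝ v (A v)) :
    ∃ a > 0, ∀ v, a * ‖v‖ ^ 2 ≤ inner ℝ v (A v) := by
  obtain ⟨a, ha, hle⟩ := (isCompact_sphere (0 : E) 1).exists_forall_le'
    (f := fun v => inner ℝ v (A v)) (by fun_prop)
    (fun v hv => hA v (ne_zero_of_mem_unit_sphere ⟨v, hv⟩))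
  refine ⟨a, ha, fun v => ?_⟩
  obtain rfl | hv := eq_or_ne v 0
  · simp
  · have h := hle (‖v‖⁻¹ • v) (by simp [norm_smul, hv])
    rw [map_smul, real_inner_smul_left, real_inner_smul_right, ← mul_assoc, ← sq, inv_pow,
      inv_mul_eq_div, le_div_iff₀ (by positivity)] at h
    exact h

variable [MeasurableSpace E] [BorelSpace E]

theorem integrable_exp_neg_mul_sq_norm {a : ℝ} (ha : 0 < a) :
    Integrable (fun v : E => Real.exp (-(a * ‖v‖ ^ 2))) := by
  have h := (GaussianFourier.integrable_cexp_neg_mul_sq_norm_add (V := E) (b := (a : ℂ))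
    (by simpa using ha) 0 0).norm
  simpa [Complex.norm_exp, ← Complex.ofReal_pow] using h

theorem analyticAt_integral_exp_gaussianStat {A : E →L[ℝ] E}
    (hA : ∀ v ≠ 0, 0 < inner ℝ v (A v)) (c : E) (D : Set E) :
    AnalyticAt ℝ (fun ξ => ∫ v in D, Real.exp (gaussianStat v ξ)) (A, c) := by
  obtain ⟨a, ha, hle⟩ := exists_pos_mul_sq_norm_le_inner hA
  have hint := (integrable_exp_neg_mul_sq_norm (E := E)
    (show 0 < a / 8 by positivity)).const_mul (Real.exp ((‖c‖ + a / 4) ^ 2 / a))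
  simp only [← Real.exp_add] at hint
  exact analyticAt_integral_exp_dual (by positivity)
    continuous_gaussianStat.aestronglyMeasurable
    (.of_forall (gaussianStat_add_mul_norm_le c ha hle)) hint.integrableOn

end QuadraticExponential

section GaussianDensity

theorem map_withDensity_comp {α β : Type*} [MeasurableSpace α] [MeasurableSpace β]
    (μ : Measure α) {g : α → β} (hg : Measurable g) {f : β → ENNReal} (hf : Measurable f) :
    (μ.withDensity (f ∘ g)).map g = (μ.map g).withDensity f := by
  ext s hs
  rw [Measure.map_apply hg hs, withDensity_apply _ (hg hs), withDensity_apply _ hs,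
    setLIntegral_map hs hf hg]
  rfl

section InnerProductSpace

variable {E : Type*} [NormedAddCommGroup E] [InnerProductSpace ℝ E] [FiniteDimensional ℝ E]
  [MeasurableSpace E] [BorelSpace E]

/-- The measure with density `v ↦ exp (-⟪v, A v⟫ / 2)`: the unnormalised centred Gaussian measure
with precision operator `A`. -/
noncomputable def gaussianWeight (A : E →L[ℝ] E) : Measure E :=
  volume.withDensity fun v => ENNReal.ofReal (Real.exp (gaussianStat v (A, 0)))

theorem gaussianWeight_real_apply (A : E →L[ℝ] E) {s : Set E} (hs : MeasurableSet s) :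
    (gaussianWeight A).real s = ∫ v in s, Real.exp (gaussianStat v (A, 0)) := by
  rw [integral_eq_lintegral_of_nonneg_ae (.of_forall fun _ => (Real.exp_pos _).le)
    (continuous_exp_gaussianStat _).aestronglyMeasurable, Measure.real, gaussianWeight,
    withDensity_apply _ hs]

theorem isOpenPosMeasure_gaussianWeight (A : E →L[ℝ] E) :
    (gaussianWeight A).IsOpenPosMeasure :=
  (withDensity_absolutelyContinuous'
    (continuous_exp_gaussianStat _).measurable.ennreal_ofReal.aemeasurable
    (.of_forall fun _ => (ENNReal.ofReal_pos.2 (Real.exp_pos _)).ne')).isOpenPosMeasure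

theorem exists_map_gaussianWeight_eq_smul (A : E →L[ℝ] E) {B : E →L[ℝ] E}
    (hB : LinearMap.det (B : E →ₗ[ℝ] E) ≠ 0) :
    ∃ c : ENNReal, (gaussianWeight (B.adjoint * A * B)).map B = c • gaussianWeight A := by
  have hstat (v : E) : gaussianStat v (B.adjoint * A * B, 0) = gaussianStat (B v) (A, 0) := by
    simp [gaussianStat_apply, ContinuousLinearMap.adjoint_inner_right]
  have hmap := Measure.map_linearMap_addHaar_eq_smul_addHaar (volume : Measure E) hB
  rw [ContinuousLinearMap.coe_coe] at hmap
  simp_rw [gaussianWeight, hstat, ← withDensity_smul_measure]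
  exact ⟨_, hmap ▸ map_withDensity_comp volume B.continuous.measurable
    (continuous_exp_gaussianStat (A, 0)).measurable.ennreal_ofReal⟩

theorem charFun_gaussianWeight_one (t : E) :
    charFun (gaussianWeight (1 : E →L[ℝ] E)) t =
      (gaussianWeight (1 : E →L[ℝ] E)).real Set.univ * charFun (stdGaussian E) t := by
  have hformula (t : E) : charFun (gaussianWeight (1 : E →L[ℝ] E)) t =
      (Real.pi / (1 / 2 : ℂ)) ^ (Module.finrank ℝ E / 2 : ℂ) * Complex.exp (-‖t‖ ^ 2 / 2) := by
    have h := GaussianFourier.integral_cexp_neg_mul_sq_norm_add (b := (1 / 2 : ℂ)) (by norm_num)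
      Complex.I t
    rw [charFun_apply, gaussianWeight, integral_withDensity_eq_integral_toReal_smul₀
      (continuous_exp_gaussianStat _).measurable.ennreal_ofReal.aemeasurable
      (.of_forall fun _ => ENNReal.ofReal_lt_top)]
    convert! h using 2
    · ext v
      rw [ENNReal.toReal_ofReal (Real.exp_pos _).le, Complex.real_smul, Complex.ofReal_exp,
        ← Complex.exp_add, gaussianStat_one_zero, real_inner_comm t v, mul_comm _ Complex.I]
      push_cast
      ring_nf
    · rw [Complex.I_sq]
      ring_nf
  have h0 := hformula 0
  rw [charFun_zero] at h0
  rw [hformula, h0, charFun_stdGaussian]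
  simp

theorem isFiniteMeasure_gaussianWeight_one :
    IsFiniteMeasure (gaussianWeight (1 : E →L[ℝ] E)) := by
  refine isFiniteMeasure_withDensity_ofReal ?_
  simp only [gaussianStat_one_zero]
  exact (integrable_exp_neg_mul_sq_norm (by norm_num)).2

theorem exists_stdGaussian_eq_smul :
    ∃ c : ENNReal, stdGaussian E = c • gaussianWeight (1 : E →L[ℝ] E) := by
  set ν := gaussianWeight (1 : E →L[ℝ] E)
  have := isFiniteMeasure_gaussianWeight_one (E := E)
  have hν0 : ν Set.univ ≠ 0 := by
    have := isOpenPosMeasure_gaussianWeight (1 : E →L[ℝ] E)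
    exact isOpen_univ.measure_ne_zero ν Set.univ_nonempty
  have hc : (ν Set.univ)⁻¹ ≠ ⊤ := ENNReal.inv_ne_top.2 hν0
  have := ν.smul_finite hc
  refine ⟨(ν Set.univ)⁻¹, Measure.ext_of_charFun (funext fun t => ?_)⟩
  have hsmul : charFun ((ν Set.univ)⁻¹ • ν) t = (ν Set.univ)⁻¹.toReal * charFun ν t := by
    rw [charFun_apply, charFun_apply, integral_smul_measure, Complex.real_smul]
  have hreal : ν.real Set.univ ≠ 0 := ENNReal.toReal_ne_zero.2 ⟨hν0, measure_ne_top _ _⟩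
  rw [hsmul, charFun_gaussianWeight_one, ← mul_assoc, ENNReal.toReal_inv, ← Complex.ofReal_mul,
    ← Measure.real, inv_mul_cancel₀ hreal, Complex.ofReal_one, one_mul]

end InnerProductSpace

variable {ι : Type*} [Fintype ι] [DecidableEq ι] {S : Matrix ι ι ℝ}

open scoped MatrixOrder in
theorem exists_multivariateGaussian_eq_smul (hS : S.PosDef) :
    ∃ c : ENNReal, c ≠ 0 ∧ multivariateGaussian 0 S =
      c • gaussianWeight (Matrix.toEuclideanCLM (𝕜 := ℝ) S⁻¹) := by
  set R := CFC.sqrt S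
  set B := Matrix.toEuclideanCLM (𝕜 := ℝ) R
  have hRR : R * R = S := CFC.sqrt_mul_sqrt_self S hS.posSemidef.nonneg
  have hR : IsUnit R := CFC.isUnit_sqrt_iff_isStrictlyPositive.2 hS.isStrictlyPositive
  have hB : LinearMap.det (B : EuclideanSpace ℝ ι →ₗ[ℝ] EuclideanSpace ℝ ι) ≠ 0 := by
    rw [Matrix.coe_toEuclideanCLM_eq_toEuclideanLin, Matrix.toEuclideanLin,
      Matrix.toLpLin_eq_toLin, LinearMap.det_toLin]
    exact ((Matrix.isUnit_iff_isUnit_det R).1 hR).ne_zero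
  have hconj : B.adjoint * Matrix.toEuclideanCLM (𝕜 := ℝ) S⁻¹ * B = 1 := by
    have hstar : star R = R := (CFC.sqrt_nonneg S).isSelfAdjoint
    have hRdet := (Matrix.isUnit_iff_isUnit_det R).1 hR
    rw [← ContinuousLinearMap.star_eq_adjoint, ← map_star, hstar, ← map_mul, ← map_mul, ← hRR,
      Matrix.mul_inv_rev, ← mul_assoc, Matrix.mul_nonsing_inv _ hRdet, one_mul,
      Matrix.nonsing_inv_mul _ hRdet, map_one]
  obtain ⟨c, hc⟩ := exists_stdGaussian_eq_smul (E := EuclideanSpace ℝ ι)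
  obtain ⟨c', hc'⟩ := exists_map_gaussianWeight_eq_smul (Matrix.toEuclideanCLM (𝕜 := ℝ) S⁻¹) hB
  have heq : multivariateGaussian 0 S =
      (c * c') • gaussianWeight (Matrix.toEuclideanCLM (𝕜 := ℝ) S⁻¹) := by
    rw [hconj] at hc'
    simp only [multivariateGaussian, zero_add]
    rw [hc, Measure.map_smul, hc', smul_smul]
  refine ⟨c * c', fun h0 => ?_, heq⟩
  rw [h0, zero_smul] at heq
  exact IsProbabilityMeasure.ne_zero _ heq

end GaussianDensity

section MatrixSmoothness

variable {G : Type*} [NormedAddCommGroup G] [NormedSpace ℝ G] {κ : Type*} [Fintype κ]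
  {n : WithTop ℕ∞} {e₀ : G}

theorem contDiffAt_det [DecidableEq κ] {S : G → Matrix κ κ ℝ}
    (hS : ∀ i j, ContDiffAt ℝ n (fun e => S e i j) e₀) :
    ContDiffAt ℝ n (fun e => (S e).det) e₀ := by
  simp only [Matrix.det_apply]
  exact ContDiffAt.sum fun σ _ => (contDiffAt_prod fun i _ => hS _ _).const_smul _

theorem contDiffAt_matrix_inv [DecidableEq κ] {S : G → Matrix κ κ ℝ}
    (hS : ∀ i j, ContDiffAt ℝ n (fun e => S e i j) e₀) (h0 : (S e₀).det ≠ 0) (i j : κ) :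
    ContDiffAt ℝ n (fun e => (S e)⁻¹ i j) e₀ := by
  simp only [Matrix.inv_def, Ring.inverse_eq_inv', Matrix.smul_apply, smul_eq_mul,
    Matrix.adjugate_apply]
  refine ((contDiffAt_det hS).inv h0).mul (contDiffAt_det fun k l => ?_)
  obtain rfl | hk := eq_or_ne k j
  · simpa only [Matrix.updateRow_self] using contDiffAt_const
  · simpa only [Matrix.updateRow_ne hk] using hS k l

theorem contDiffAt_dotProduct {a b : G → κ → ℝ}
    (ha : ∀ i, ContDiffAt ℝ n (fun e => a e i) e₀)
    (hb : ∀ i, ContDiffAt ℝ n (fun e => b e i) e₀) :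
    ContDiffAt ℝ n (fun e => a e ⬝ᵥ b e) e₀ :=
  ContDiffAt.sum fun j _ => (ha j).mul (hb j)

theorem contDiffAt_mulVec {κ' : Type*} {S : G → Matrix κ' κ ℝ} {b : G → κ → ℝ}
    (hS : ∀ i j, ContDiffAt ℝ n (fun e => S e i j) e₀)
    (hb : ∀ i, ContDiffAt ℝ n (fun e => b e i) e₀) (i : κ') :
    ContDiffAt ℝ n (fun e => (S e *ᵥ b e) i) e₀ :=
  contDiffAt_dotProduct (hS i) hb

theorem contDiffAt_toEuclideanCLM [DecidableEq κ] {S : G → Matrix κ κ ℝ}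
    (hS : ∀ i j, ContDiffAt ℝ n (fun e => S e i j) e₀) :
    ContDiffAt ℝ n (fun e => Matrix.toEuclideanCLM (𝕜 := ℝ) (S e)) e₀ := by
  have hsum (e : G) : Matrix.toEuclideanCLM (𝕜 := ℝ) (S e) =
      ∑ i, ∑ j, S e i j • Matrix.toEuclideanCLM (𝕜 := ℝ) (Matrix.single i j 1) := by
    conv_lhs => rw [Matrix.matrix_eq_sum_single (S e)]
    simp only [map_sum, ← map_smul, Matrix.smul_single, smul_eq_mul, mul_one]
  simp only [hsum]
  exact ContDiffAt.sum fun i _ => ContDiffAt.sum fun j _ => (hS i j).smul contDiffAt_const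

end MatrixSmoothness

section Orthants

theorem gaussianStat_add {E : Type*} [NormedAddCommGroup E] [InnerProductSpace ℝ E]
    {A : E →L[ℝ] E} (hA : A.toLinearMap.IsSymmetric) (v b : E) :
    gaussianStat (v + b) (A, 0) = gaussianStat b (A, 0) + gaussianStat v (A, A b) := by
  have hsymm : inner ℝ b (A v) = inner ℝ v (A b) := (hA b v).symm.trans (real_inner_comm _ _)
  simp only [gaussianStat_apply, map_add, inner_add_left, inner_add_right, inner_zero_right, hsymm]
  ring

variable {ι : Type*} [Fintype ι] [DecidableEq ι] {S : Matrix ι ι ℝ}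

theorem isOpenPosMeasure_multivariateGaussian (hS : S.PosDef) :
    (multivariateGaussian 0 S).IsOpenPosMeasure := by
  obtain ⟨c, hc, heq⟩ := exists_multivariateGaussian_eq_smul hS
  have := isOpenPosMeasure_gaussianWeight (Matrix.toEuclideanCLM (𝕜 := ℝ) S⁻¹)
  exact heq ▸ Measure.isOpenPosMeasure_smul _ hc

theorem multivariateGaussian_real_eq_div (hS : S.PosDef) {s : Set (EuclideanSpace ℝ ι)}
    (hs : MeasurableSet s) : (multivariateGaussian 0 S).real s =
      (∫ v in s, Real.exp (gaussianStat v (Matrix.toEuclideanCLM (𝕜 := ℝ) S⁻¹, 0))) /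
        ∫ v, Real.exp (gaussianStat v (Matrix.toEuclideanCLM (𝕜 := ℝ) S⁻¹, 0)) := by
  obtain ⟨c, -, heq⟩ := exists_multivariateGaussian_eq_smul hS
  have huniv : (multivariateGaussian 0 S).real Set.univ = 1 := probReal_univ
  rw [heq, measureReal_ennreal_smul_apply, gaussianWeight_real_apply _ .univ,
    setIntegral_univ] at huniv
  rw [heq, measureReal_ennreal_smul_apply, gaussianWeight_real_apply _ hs,
    eq_div_iff (right_ne_zero_of_mul_eq_one huniv), mul_right_comm, huniv, one_mul]

theorem inner_toEuclideanCLM_pos (hS : S.PosDef) {v : EuclideanSpace ℝ ι} (hv : v ≠ 0) :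
    0 < inner ℝ v (Matrix.toEuclideanCLM (𝕜 := ℝ) S v) := by
  rw [Matrix.inner_toEuclideanCLM]
  exact hS.dotProduct_mulVec_pos (by simpa using hv)

theorem multivariateGaussian_real_orthant (hS : S.PosDef) (s : Set ι) (b : ι → ℝ) :
    (multivariateGaussian 0 S).real {u | ∀ i ∈ s, u i ≤ b i} =
      Real.exp (gaussianStat (WithLp.toLp 2 b) (Matrix.toEuclideanCLM (𝕜 := ℝ) S⁻¹, 0)) *
        (∫ v in {v : EuclideanSpace ℝ ι | ∀ i ∈ s, v i ≤ 0},
          Real.exp (gaussianStat v (Matrix.toEuclideanCLM (𝕜 := ℝ) S⁻¹,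
            Matrix.toEuclideanCLM (𝕜 := ℝ) S⁻¹ (WithLp.toLp 2 b)))) /
        ∫ v, Real.exp (gaussianStat v (Matrix.toEuclideanCLM (𝕜 := ℝ) S⁻¹, 0)) := by
  have hmeas : MeasurableSet {u : EuclideanSpace ℝ ι | ∀ i ∈ s, u i ≤ b i} := by
    simp only [Set.ofPred_forall]
    exact MeasurableSet.iInter fun i => MeasurableSet.iInter fun _ =>
      measurableSet_le (by fun_prop) measurable_const
  have hsymm : (Matrix.toEuclideanCLM (𝕜 := ℝ) S⁻¹).toLinearMap.IsSymmetric := by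
    rw [Matrix.coe_toEuclideanCLM_eq_toEuclideanLin]
    exact Matrix.isSymmetric_toEuclideanLin_iff.2 hS.inv.isHermitian
  rw [multivariateGaussian_real_eq_div hS hmeas]
  congr 1
  rw [← (measurePreserving_add_right volume (WithLp.toLp 2 b)).setIntegral_preimage_emb
    (MeasurableEquiv.addRight _).measurableEmbedding, ← integral_const_mul]
  simp only [gaussianStat_add hsymm, Real.exp_add, Set.preimage_ofPred_eq, PiLp.add_apply,
    add_le_iff_nonpos_left]

theorem multivariateGaussian_real_orthant_pos (hS : S.PosDef) (b : ι → ℝ) :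
    0 < (multivariateGaussian 0 S).real {u | ∀ i, u i ≤ b i} := by
  have := isOpenPosMeasure_multivariateGaussian hS
  have hopen : IsOpen {u : EuclideanSpace ℝ ι | ∀ i, u i < b i} := by
    simp only [Set.ofPred_forall]
    exact isOpen_iInter_of_finite fun i => isOpen_lt (by fun_prop) continuous_const
  have hpos := hopen.measure_pos (multivariateGaussian 0 S)
    ⟨WithLp.toLp 2 fun i => b i - 1, fun i => sub_one_lt _⟩
  exact ENNReal.toReal_pos (hpos.trans_le (measure_mono fun u hu i => (hu i).le)).ne'
    (measure_ne_top _ _)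

theorem contDiffAt_multivariateGaussian_real {G : Type*} [NormedAddCommGroup G] [NormedSpace ℝ G]
    {n : WithTop ℕ∞} {e₀ : G} {S : G → Matrix ι ι ℝ} {b : G → ι → ℝ}
    (hS : ∀ i j, ContDiffAt ℝ n (fun e => S e i j) e₀)
    (hb : ∀ i, ContDiffAt ℝ n (fun e => b e i) e₀) (hpd : ∀ᶠ e in 𝓝 e₀, (S e).PosDef)
    (s : Set ι) :
    ContDiffAt ℝ n
      (fun e => (multivariateGaussian 0 (S e)).real {u | ∀ i ∈ s, u i ≤ b e i}) e₀ := by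
  have hpd₀ := hpd.self_of_nhds
  have hA := contDiffAt_toEuclideanCLM (contDiffAt_matrix_inv hS hpd₀.det_pos.ne')
  have hβ : ContDiffAt ℝ n (fun e => WithLp.toLp 2 (b e)) e₀ := contDiffAt_euclidean.2 hb
  have hlaplace (D : Set (EuclideanSpace ℝ ι)) (c : EuclideanSpace ℝ ι) :=
    (analyticAt_integral_exp_gaussianStat (fun v hv => inner_toEuclideanCLM_pos hpd₀.inv hv)
      c D).contDiffAt (n := n)
  refine ContDiffAt.congr_of_eventuallyEq ?_
    (hpd.mono fun e he => multivariateGaussian_real_orthant he s (b e))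
  have hnum := ContDiffAt.comp e₀ (hlaplace {v | ∀ i ∈ s, v i ≤ 0} _)
    (hA.prodMk (hA.clm_apply hβ))
  have hden := ContDiffAt.comp e₀ (hlaplace Set.univ 0) (hA.prodMk contDiffAt_const)
  simp only [setIntegral_univ] at hden
  refine ((ContDiffAt.exp ?_).mul hnum).div hden ?_
  · simp only [gaussianStat_apply, inner_zero_right]
    exact ((hβ.inner ℝ (hA.clm_apply hβ)).neg.div_const 2).sub contDiffAt_const
  · intro h0
    have huniv := multivariateGaussian_real_eq_div hpd₀ .univ
    rw [h0, div_zero, probReal_univ] at huniv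
    exact one_ne_zero huniv

end Orthants

section IndicatorCovariance

theorem det_covariance_ne_zero {Ω : Type*} [MeasurableSpace Ω] {μ : Measure Ω}
    [IsProbabilityMeasure μ] {κ : Type*} [Fintype κ] [DecidableEq κ] {X : κ → Ω → ℝ}
    (hX : ∀ i, MemLp (X i) 2 μ)
    (hind : ∀ (c : κ → ℝ) (a : ℝ), (∀ᵐ ω ∂μ, ∑ i, c i * X i ω = a) → c = 0) :
    (Matrix.of fun i l => cov[X i, X l; μ]).det ≠ 0 := by
  intro hdet
  obtain ⟨c, hc, hker⟩ := Matrix.exists_mulVec_eq_zero_iff.2 hdet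
  have hcX (i : κ) : MemLp (fun ω => c i * X i ω) 2 μ := (hX i).const_mul (c i)
  have hsum : MemLp (fun ω => ∑ i, c i * X i ω) 2 μ := memLp_finsetSum _ fun i _ => hcX i
  have hvar : Var[fun ω => ∑ i, c i * X i ω; μ] = 0 :=
    calc Var[fun ω => ∑ i, c i * X i ω; μ]
        = ∑ i, ∑ l, cov[fun ω => c i * X i ω, fun ω => c l * X l ω; μ] := by
          rw [← covariance_self hsum.aemeasurable, covariance_fun_sum_fun_sum hcX hcX]
      _ = ∑ i, c i * ∑ l, cov[X i, X l; μ] * c l := by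
          simp only [covariance_const_mul_left, covariance_const_mul_right, Finset.mul_sum]
          exact Finset.sum_congr rfl fun i _ => Finset.sum_congr rfl fun l _ => by ring
      _ = 0 := Finset.sum_eq_zero fun i _ => mul_eq_zero_of_right _ (congrFun hker i)
  exact hc (hind c _ (ae_eq_integral_of_variance_eq_zero hsum hvar))

variable {D : ℕ} (b : Fin D → ℝ) (R : Matrix (Fin D) (Fin D) ℝ)

theorem ind_of_le {b : Fin D → ℝ} {i : Fin D} {u : EuclideanSpace ℝ (Fin D)} (h : u i ≤ b i) :
    ind b i u = 1 :=
  Set.indicator_of_mem (s := {v : EuclideanSpace ℝ (Fin D) | v i ≤ b i}) h _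

theorem ind_of_lt {b : Fin D → ℝ} {i : Fin D} {u : EuclideanSpace ℝ (Fin D)} (h : b i < u i) :
    ind b i u = 0 :=
  Set.indicator_of_notMem (s := {v : EuclideanSpace ℝ (Fin D) | v i ≤ b i}) h.not_ge _

theorem measurableSet_coord_le (i : Fin D) :
    MeasurableSet {v : EuclideanSpace ℝ (Fin D) | v i ≤ b i} :=
  measurableSet_le (by fun_prop) measurable_const

theorem memLp_ind (i : Fin D) (μ : Measure (EuclideanSpace ℝ (Fin D))) [IsFiniteMeasure μ] :
    MemLp (ind b i) 2 μ :=
  (memLp_const (1 : ℝ)).indicator (measurableSet_coord_le b i)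

theorem indCov_eq_sub (i j : Fin D) :
    indCov b R i j =
      (multivariateGaussian 0 R).real {u | ∀ k ∈ ({i, j} : Set (Fin D)), u k ≤ b k} -
        (multivariateGaussian 0 R).real {u | ∀ k ∈ ({i} : Set (Fin D)), u k ≤ b k} *
          (multivariateGaussian 0 R).real {u | ∀ k ∈ ({j} : Set (Fin D)), u k ≤ b k} := by
  have hmul : ind b i * ind b j = Set.indicator ({v | v i ≤ b i} ∩ {v | v j ≤ b j}) 1 :=
    (Set.inter_indicator_one (M₀ := ℝ)).symm
  simp only [Set.mem_insert_iff, Set.mem_singleton_iff, forall_eq_or_imp, forall_eq]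
  rw [indCov, covariance_eq_sub (memLp_ind b i _) (memLp_ind b j _), hmul,
    integral_indicator_one ((measurableSet_coord_le b i).inter (measurableSet_coord_le b j))]
  congr 2
  · exact integral_indicator_one (measurableSet_coord_le b i)
  · exact integral_indicator_one (measurableSet_coord_le b j)

variable {κ : Type*} [Fintype κ] {f : κ → Fin D}

theorem eq_zero_of_sum_ind_ae_eq_const {μ : Measure (EuclideanSpace ℝ (Fin D))}
    [μ.IsOpenPosMeasure] (hf : f.Injective) {c : κ → ℝ} {a : ℝ}
    (h : ∀ᵐ u ∂μ, ∑ i, c i * ind b (f i) u = a) : c = 0 := by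
  classical
  have hexists {U : Set (EuclideanSpace ℝ (Fin D))} (hU : IsOpen U) (hne : U.Nonempty) :
      ∃ u ∈ U, ∑ i, c i * ind b (f i) u = a := by
    by_contra! hcon
    exact hU.measure_ne_zero μ hne (measure_mono_null (fun u hu => hcon u hu) h)
  have hlt (k : Fin D) : IsOpen {u : EuclideanSpace ℝ (Fin D) | u k < b k} :=
    isOpen_lt (by fun_prop) continuous_const
  have hgt (k : Fin D) : IsOpen {u : EuclideanSpace ℝ (Fin D) | b k < u k} :=
    isOpen_lt continuous_const (by fun_prop)
  ext i
  -- Compare a point with all indicators `1` to one where only the indicator of `f i` is `0`.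
  obtain ⟨u, hu, hsum⟩ := hexists (isOpen_iInter_of_finite hlt)
    ⟨WithLp.toLp 2 fun k => b k - 1, by simp⟩
  obtain ⟨v, ⟨hv, hvi⟩, hsum'⟩ := hexists
    ((isOpen_iInter_of_finite fun k => isOpen_iInter_of_finite fun _ : k ≠ f i => hlt k).inter
      (hgt (f i)))
    ⟨WithLp.toLp 2 fun k => if k = f i then b k + 1 else b k - 1, by simp +contextual⟩
  simp only [Set.mem_iInter, Set.mem_ofPred_eq] at hu hv hvi
  have hothers : ∑ k ∈ Finset.univ.erase i, c k * ind b (f k) v =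
      ∑ k ∈ Finset.univ.erase i, c k * ind b (f k) u :=
    Finset.sum_congr rfl fun k hk => by
      rw [ind_of_le (hu _).le, ind_of_le (hv _ (hf.ne (Finset.ne_of_mem_erase hk))).le]
  rw [← Finset.add_sum_erase _ _ (Finset.mem_univ i), ind_of_le (hu _).le] at hsum
  rw [← Finset.add_sum_erase _ _ (Finset.mem_univ i), ind_of_lt hvi, hothers] at hsum'
  simpa using hsum.trans hsum'.symm

variable {R}

theorem det_indCov_ne_zero [DecidableEq κ] (hR : R.PosDef) (hf : f.Injective) :
    (Matrix.of fun i l : κ => indCov b R (f i) (f l)).det ≠ 0 := by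
  have := isOpenPosMeasure_multivariateGaussian hR
  exact det_covariance_ne_zero (fun i => memLp_ind b (f i) (multivariateGaussian 0 R))
    fun _ _ => eq_zero_of_sum_ind_ae_eq_const b hf

end IndicatorCovariance

section SolowJoe

variable {G : Type*} [NormedAddCommGroup G] [NormedSpace ℝ G] {n : WithTop ℕ∞} {e₀ : G}

theorem stdNormalCDF_eq_multivariateGaussian (s : ℝ) :
    stdNormalCDF s =
      (multivariateGaussian 0 (1 : Matrix Unit Unit ℝ)).real {u | ∀ i ∈ Set.univ, u i ≤ s} := by
  have h := measurePreserving_eval_multivariateGaussian (μ := 0)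
    (Matrix.PosSemidef.one (n := Unit) (R := ℝ)) (i := ())
  have hlaw : gaussianReal 0 1 = gaussianReal ((0 : EuclideanSpace ℝ Unit) ())
      ((1 : Matrix Unit Unit ℝ) () ()).toNNReal := by simp
  rw [stdNormalCDF, cdf_eq_real, hlaw, ← h.map_eq,
    map_measureReal_apply h.measurable measurableSet_Iic]
  congr 1
  ext u
  simp [Unique.forall_iff]

theorem contDiff_stdNormalCDF : ContDiff ℝ n stdNormalCDF := by
  rw [funext stdNormalCDF_eq_multivariateGaussian, contDiff_iff_contDiffAt]
  exact fun s => contDiffAt_multivariateGaussian_real (fun _ _ => contDiffAt_const)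
    (fun _ => contDiffAt_id) (.of_forall fun _ => .one) _

variable {D : ℕ} {R : G → Matrix (Fin D) (Fin D) ℝ} {b : G → Fin D → ℝ}
  (hR : ∀ i j, ContDiffAt ℝ n (fun e => R e i j) e₀)
  (hb : ∀ i, ContDiffAt ℝ n (fun e => b e i) e₀) (hpd : ∀ᶠ e in 𝓝 e₀, (R e).PosDef)

include hR hb hpd

theorem contDiffAt_indCov (i j : Fin D) :
    ContDiffAt ℝ n (fun e => indCov (b e) (R e) i j) e₀ := by
  simp only [indCov_eq_sub]
  exact (contDiffAt_multivariateGaussian_real hR hb hpd _).sub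
    ((contDiffAt_multivariateGaussian_real hR hb hpd _).mul
      (contDiffAt_multivariateGaussian_real hR hb hpd _))

theorem contDiffAt_sjFactor (j : Fin D) :
    ContDiffAt ℝ n (fun e => sjFactor (b e) (R e) j) e₀ := by
  have hcov := contDiffAt_indCov hR hb hpd
  have hcdf (i : Fin D) : ContDiffAt ℝ n (fun e => stdNormalCDF (b e i)) e₀ :=
    contDiff_stdNormalCDF.contDiffAt.comp e₀ (hb i)
  have hinv := contDiffAt_matrix_inv (fun (i l : {i : Fin D // i < j}) => hcov i l)
    (det_indCov_ne_zero _ hpd.self_of_nhds Subtype.val_injective)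
  exact (hcdf j).add (contDiffAt_dotProduct (fun i => hcov j i)
    (contDiffAt_mulVec hinv fun i => contDiffAt_const.sub (hcdf i)))

theorem contDiffAt_sjCDF : ContDiffAt ℝ n (fun e => sjCDF (b e) (R e)) e₀ :=
  (contDiffAt_multivariateGaussian_real hR hb hpd {i | (i : ℕ) < 2}).mul
    (contDiffAt_prod fun j _ => contDiffAt_sjFactor hR hb hpd j)

end SolowJoe

section UtilityDifferences

theorem mul_mul_transpose_apply {ι κ : Type*} [Fintype κ] (N : Matrix ι κ ℝ) (M : Matrix κ κ ℝ)
    (i j : ι) : (N * M * Nᵀ) i j = N i ⬝ᵥ (M *ᵥ N j) := by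
  rw [Matrix.mul_assoc, Matrix.mul_apply]
  rfl

theorem dotProduct_mul_mul_transpose_mulVec {ι κ : Type*} [Fintype ι] [Fintype κ]
    (N : Matrix ι κ ℝ) (M : Matrix κ κ ℝ) (v : ι → ℝ) :
    v ⬝ᵥ ((N * M * Nᵀ) *ᵥ v) = (Nᵀ *ᵥ v) ⬝ᵥ (M *ᵥ (Nᵀ *ᵥ v)) := by
  rw [← Matrix.mulVec_mulVec, ← Matrix.mulVec_mulVec, Matrix.dotProduct_mulVec,
    ← Matrix.mulVec_transpose]

theorem transpose_mulVec_dotProduct {ι κ : Type*} [Fintype ι] [Fintype κ] (N : Matrix ι κ ℝ)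
    (v : ι → ℝ) (u : κ → ℝ) : (Nᵀ *ᵥ v) ⬝ᵥ u = v ⬝ᵥ (N *ᵥ u) := by
  rw [Matrix.mulVec_transpose, ← Matrix.dotProduct_mulVec]

variable {T K p q d : ℕ} (A : Finset (Fin T)) (y : A → Fin K) (x : Regressors T K p q)

/-- The matrix of the loadings of the utility differences on the random coefficients. -/
noncomputable def coefLoading : Matrix (DiffIdx A y) (Fin q) ℝ :=
  Matrix.of fun i => (x.2 i.1.1 i.1.2 - x.2 i.1.1 (y i.1.1)).ofLp

/-- The matrix of the loadings of the utility differences on the errors at occasion `s`. -/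
noncomputable def errorLoading (s : Fin T) : Matrix (DiffIdx A y) (Fin K) ℝ :=
  Matrix.of fun i => if (i.1.1 : Fin T) = s then Pi.single i.1.2 1 - Pi.single (y i.1.1) 1 else 0

variable {A y} in
theorem errorLoading_of_eq {i : DiffIdx A y} {s : Fin T} (h : (i.1.1 : Fin T) = s) :
    errorLoading A y s i = Pi.single i.1.2 1 - Pi.single (y i.1.1) 1 :=
  if_pos h

variable {A y} in
theorem errorLoading_of_ne {i : DiffIdx A y} {s : Fin T} (h : (i.1.1 : Fin T) ≠ s) :
    errorLoading A y s i = 0 :=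
  if_neg h

theorem sum_errorLoading_dotProduct (i : DiffIdx A y) (u : Fin T → Fin K → ℝ) :
    ∑ s, errorLoading A y s i ⬝ᵥ u s = u i.1.1 i.1.2 - u i.1.1 (y i.1.1) := by
  rw [Finset.sum_eq_single (i.1.1 : Fin T)]
  · rw [errorLoading_of_eq rfl, sub_dotProduct, single_one_dotProduct, single_one_dotProduct]
  · intro s _ hs
    rw [errorLoading_of_ne hs.symm, zero_dotProduct]
  · exact fun h => absurd (Finset.mem_univ _) h

theorem diffCov_eq_add_sum (m : Param K p q d) (θ : EuclideanSpace ℝ (Fin d)) :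
    diffCov m θ A y x = coefLoading A y x * m.Omega θ * (coefLoading A y x)ᵀ +
      ∑ s, errorLoading A y s * m.Sigma θ * (errorLoading A y s)ᵀ := by
  ext i j
  simp only [Matrix.add_apply, Matrix.sum_apply, mul_mul_transpose_apply]
  rw [sum_errorLoading_dotProduct]
  simp only [diffCov, Matrix.of_apply, coefLoading]
  congr 1
  split_ifs with h
  · rw [errorLoading_of_eq (by rw [h])]
    simp only [Matrix.mulVec_sub, Matrix.mulVec_single_one, Pi.sub_apply, Matrix.col_apply]
    ring
  · rw [errorLoading_of_ne fun h' => h (Subtype.ext h'.symm), Matrix.mulVec_zero]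
    exact (sub_self 0).symm

theorem dotProduct_diffCov_mulVec (m : Param K p q d) (θ : EuclideanSpace ℝ (Fin d))
    (v : DiffIdx A y → ℝ) :
    v ⬝ᵥ (diffCov m θ A y x *ᵥ v) =
      ((coefLoading A y x)ᵀ *ᵥ v) ⬝ᵥ (m.Omega θ *ᵥ ((coefLoading A y x)ᵀ *ᵥ v)) +
        ∑ s, ((errorLoading A y s)ᵀ *ᵥ v) ⬝ᵥ (m.Sigma θ *ᵥ ((errorLoading A y s)ᵀ *ᵥ v)) := by
  simp only [diffCov_eq_add_sum, Matrix.add_mulVec, dotProduct_add, Matrix.sum_mulVec,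
    dotProduct_sum, dotProduct_mul_mul_transpose_mulVec]

theorem errorLoading_transpose_mulVec_apply (v : DiffIdx A y → ℝ) (i : DiffIdx A y) :
    ((errorLoading A y i.1.1)ᵀ *ᵥ v) i.1.2 = v i := by
  rw [Matrix.mulVec, dotProduct, Finset.sum_eq_single i]
  · rw [Matrix.transpose_apply, errorLoading_of_eq rfl]
    simp [i.2]
  · intro j _ hj
    rw [Matrix.transpose_apply]
    by_cases h : (j.1.1 : Fin T) = i.1.1
    · have hocc : j.1.1 = i.1.1 := Subtype.ext h
      have halt : i.1.2 ≠ j.1.2 := fun halt => hj (Subtype.ext (Prod.ext hocc halt.symm))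
      have hbase : i.1.2 ≠ y j.1.1 := by
        rw [hocc]
        exact i.2
      simp [errorLoading_of_eq h, halt, hbase]
    · simp [errorLoading_of_ne h]
  · exact fun h => absurd (Finset.mem_univ i) h

/-- The centred utility differences `U t k - U t (y t)`, as a function of the random coefficients
and the errors. -/
noncomputable def noiseDiff (w : EuclideanSpace ℝ (Fin q) × (Fin T → EuclideanSpace ℝ (Fin K))) :
    EuclideanSpace ℝ (DiffIdx A y) :=
  WithLp.toLp 2 fun i => inner ℝ (x.2 i.1.1 i.1.2 - x.2 i.1.1 (y i.1.1)) w.1 +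
    (w.2 i.1.1 i.1.2 - w.2 i.1.1 (y i.1.1))

theorem measurable_noiseDiff : Measurable (noiseDiff A y x) := by
  unfold noiseDiff
  fun_prop

theorem inner_noiseDiff (w : EuclideanSpace ℝ (Fin q) × (Fin T → EuclideanSpace ℝ (Fin K)))
    (v : EuclideanSpace ℝ (DiffIdx A y)) :
    inner ℝ (noiseDiff A y x w) v =
      inner ℝ w.1 (WithLp.toLp 2 ((coefLoading A y x)ᵀ *ᵥ v.ofLp)) +
        ∑ s, inner ℝ (w.2 s) (WithLp.toLp 2 ((errorLoading A y s)ᵀ *ᵥ v.ofLp)) := by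
  simp only [EuclideanSpace.inner_eq_star_dotProduct, star_trivial, transpose_mulVec_dotProduct]
  rw [← dotProduct_sum, ← dotProduct_add]
  congr 1
  ext i
  rw [Pi.add_apply, Finset.sum_apply]
  refine congrArg₂ (· + ·) ?_ (sum_errorLoading_dotProduct A y i fun s => (w.2 s).ofLp).symm
  rw [EuclideanSpace.inner_eq_star_dotProduct, star_trivial, dotProduct_comm]
  rfl

theorem utility_le_iff_noiseDiff_le (m : Param K p q d) (θ : EuclideanSpace ℝ (Fin d))
    (w : EuclideanSpace ℝ (Fin q) × (Fin T → EuclideanSpace ℝ (Fin K))) (i : DiffIdx A y) :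
    utility (m.beta θ) x w i.1.1 i.1.2 ≤ utility (m.beta θ) x w i.1.1 (y i.1.1) ↔
      noiseDiff A y x w i ≤ diffLimit m θ A y x i := by
  simp only [utility, noiseDiff, diffLimit, inner_sub_left]
  constructor <;> intro h <;> linarith

theorem corr_eq_diagonal_mul (m : Param K p q d) (θ : EuclideanSpace ℝ (Fin d)) :
    corr m θ A y x = Matrix.diagonal (fun i => (√(diffCov m θ A y x i i))⁻¹) *
      diffCov m θ A y x * (Matrix.diagonal fun i => (√(diffCov m θ A y x i i))⁻¹)ᴴ := by
  ext i j
  simp only [corr, Matrix.of_apply, Matrix.diagonal_conjTranspose, star_trivial,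
    Matrix.mul_diagonal, Matrix.diagonal_mul, div_eq_mul_inv, mul_inv]
  ring

variable {m : Param K p q d} {θ : EuclideanSpace ℝ (Fin d)}

theorem posSemidef_diffCov (hO : (m.Omega θ).PosSemidef) (hS : (m.Sigma θ).PosSemidef) :
    (diffCov m θ A y x).PosSemidef := by
  rw [diffCov_eq_add_sum]
  exact (hO.mul_mul_conjTranspose_same (coefLoading A y x)).add
    (Matrix.posSemidef_sum _ fun s _ => hS.mul_mul_conjTranspose_same (errorLoading A y s))

theorem integral_exp_inner_noiseLaw (hO : (m.Omega θ).PosSemidef)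
    (hS : (m.Sigma θ).PosSemidef) (a : EuclideanSpace ℝ (Fin q))
    (c : Fin T → EuclideanSpace ℝ (Fin K)) :
    ∫ w, Complex.exp ((inner ℝ w.1 a + ∑ s, inner ℝ (w.2 s) (c s) : ℝ) * Complex.I)
        ∂noiseLaw T m θ =
      Complex.exp (-(a.ofLp ⬝ᵥ (m.Omega θ *ᵥ a.ofLp) +
        ∑ s, (c s).ofLp ⬝ᵥ (m.Sigma θ *ᵥ (c s).ofLp) : ℝ) / 2) := by
  simp_rw [Complex.ofReal_add, Complex.ofReal_sum, add_mul, Finset.sum_mul, Complex.exp_add,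
    Complex.exp_sum]
  rw [noiseLaw, integral_prod_mul
    (fun u => Complex.exp (((inner ℝ u a : ℝ) : ℂ) * Complex.I))
    (fun u : Fin T → EuclideanSpace ℝ (Fin K) =>
      ∏ s, Complex.exp (((inner ℝ (u s) (c s) : ℝ) : ℂ) * Complex.I)),
    integral_fintype_prod_eq_prod (f := fun s (u : EuclideanSpace ℝ (Fin K)) =>
      Complex.exp (((inner ℝ u (c s) : ℝ) : ℂ) * Complex.I))]
  simp_rw [← charFun_apply, charFun_multivariateGaussian hO, charFun_multivariateGaussian hS,
    ← Complex.exp_sum, ← Complex.exp_add]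
  congr 1
  simp only [inner_zero_right, Complex.ofReal_zero, zero_mul, zero_sub, Finset.sum_neg_distrib,
    ← Finset.sum_div]
  ring

theorem map_noiseDiff (hO : (m.Omega θ).PosSemidef) (hS : (m.Sigma θ).PosSemidef) :
    (noiseLaw T m θ).map (noiseDiff A y x) = multivariateGaussian 0 (diffCov m θ A y x) := by
  have : IsProbabilityMeasure (noiseLaw T m θ) := by
    unfold noiseLaw
    infer_instance
  have := Measure.isProbabilityMeasure_map (μ := noiseLaw T m θ)
    (measurable_noiseDiff A y x).aemeasurable
  refine Measure.ext_of_charFun (E := EuclideanSpace ℝ (DiffIdx A y)) (funext fun v => ?_)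
  rw [charFun_multivariateGaussian (posSemidef_diffCov A y x hO hS), charFun_apply,
    integral_map (measurable_noiseDiff A y x).aemeasurable (by fun_prop)]
  simp_rw [inner_noiseDiff, integral_exp_inner_noiseLaw hO hS, ← dotProduct_diffCov_mulVec]
  simp [neg_div]

variable (hO : (m.Omega θ).PosSemidef) (hS : (m.Sigma θ).PosDef)

include hO hS

theorem posDef_diffCov : (diffCov m θ A y x).PosDef := by
  refine .of_dotProduct_mulVec_pos (posSemidef_diffCov A y x hO hS.posSemidef).isHermitian
    fun v hv => ?_
  obtain ⟨i, hi⟩ := Function.ne_iff.1 hv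
  have hload : (errorLoading A y i.1.1)ᵀ *ᵥ v ≠ 0 := fun h0 =>
    hi (by rw [← errorLoading_transpose_mulVec_apply A y v i, h0]; rfl)
  rw [star_trivial, dotProduct_diffCov_mulVec]
  exact add_pos_of_nonneg_of_pos (hO.dotProduct_mulVec_nonneg _)
    (Finset.sum_pos' (fun s _ => hS.posSemidef.dotProduct_mulVec_nonneg _)
      ⟨i.1.1, Finset.mem_univ _, hS.dotProduct_mulVec_pos hload⟩)

theorem posDef_corr : (corr m θ A y x).PosDef := by
  have hcov := posDef_diffCov A y x hO hS
  rw [corr_eq_diagonal_mul]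
  refine hcov.mul_mul_conjTranspose_same (Matrix.vecMul_injective_of_isUnit ?_)
  rw [Matrix.isUnit_iff_isUnit_det, Matrix.det_diagonal, isUnit_iff_ne_zero,
    Finset.prod_ne_zero_iff]
  exact fun i _ => inv_ne_zero (Real.sqrt_pos.2 hcov.diag_pos).ne'

theorem mnpProb_eq_multivariateGaussian :
    mnpProb m θ A y x = (multivariateGaussian 0 (diffCov m θ A y x)).real
      {u | ∀ i ∈ Set.univ, u i ≤ diffLimit m θ A y x i} := by
  have horthant : MeasurableSet {u : EuclideanSpace ℝ (DiffIdx A y) |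
      ∀ i ∈ Set.univ, u i ≤ diffLimit m θ A y x i} := by
    simp only [Set.ofPred_forall]
    exact MeasurableSet.iInter fun i => MeasurableSet.iInter fun _ =>
      measurableSet_le (by fun_prop) measurable_const
  rw [← map_noiseDiff A y x hO hS.posSemidef,
    map_measureReal_apply (measurable_noiseDiff A y x) horthant, mnpProb]
  congr 1
  ext w
  simp only [Set.mem_ofPred_eq, Set.mem_preimage, Set.mem_univ, true_imp_iff,
    ← utility_le_iff_noiseDiff_le]
  refine ⟨fun h i => h i.1.1 i.1.2, fun h t k => ?_⟩
  by_cases hk : k = y t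
  · rw [hk]
  · exact h ⟨(t, k), hk⟩

theorem mnpProb_pos : 0 < mnpProb m θ A y x := by
  rw [mnpProb_eq_multivariateGaussian A y x hO hS]
  simpa only [Set.mem_univ, true_imp_iff] using
    multivariateGaussian_real_orthant_pos (posDef_diffCov A y x hO hS) (diffLimit m θ A y x)

end UtilityDifferences

section PartialDerivatives

variable {E X F : Type*} [NormedAddCommGroup E] [NormedSpace ℝ E] [NormedAddCommGroup X]
  [NormedSpace ℝ X] [NormedAddCommGroup F] [NormedSpace ℝ F]

theorem iteratedFDeriv_comp_continuousLinearMap {f : E → F} (g : X →L[ℝ] E) {x : X} {k : ℕ}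
    (hf : ContDiffAt ℝ k f (g x)) :
    iteratedFDeriv ℝ k (f ∘ g) x =
      (iteratedFDeriv ℝ k f (g x)).compContinuousLinearMap fun _ => g := by
  obtain ⟨u, hu, hfu⟩ := hf.contDiffOn le_rfl (by simp)
  obtain ⟨v, hvu, hv, hxv⟩ := mem_nhds_iff.1 hu
  have hpre : IsOpen (g ⁻¹' v) := hv.preimage g.continuous
  rw [← iteratedFDerivWithin_of_isOpen k hpre hxv, ← iteratedFDerivWithin_of_isOpen k hv hxv]
  exact g.iteratedFDerivWithin_comp_right (hfu.mono hvu) hv.uniqueDiffOn hpre.uniqueDiffOn hxv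
    le_rfl

theorem norm_iteratedFDeriv_prodMk_right_le {f : E × X → F} {k : ℕ} {θ : E} {x : X}
    (hf : ContDiffAt ℝ k f (θ, x)) :
    ‖iteratedFDeriv ℝ k (fun θ => f (θ, x)) θ‖ ≤ ‖iteratedFDeriv ℝ k f (θ, x)‖ := by
  have hbase : ContinuousLinearMap.inl ℝ E X θ + (0, x) = (θ, x) := by simp
  have hshift : ContDiffAt ℝ k (fun a => f (a + (0, x))) (ContinuousLinearMap.inl ℝ E X θ) :=
    ContDiffAt.comp _ (by rwa [hbase]) (by fun_prop)
  have hcomp : (fun θ => f (θ, x)) =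
      (fun a => f (a + (0, x))) ∘ ContinuousLinearMap.inl ℝ E X := by
    ext θ
    simp
  rw [hcomp, iteratedFDeriv_comp_continuousLinearMap _ hshift, iteratedFDeriv_comp_add_right,
    hbase]
  refine (ContinuousMultilinearMap.norm_compContinuousLinearMap_le _ _).trans
    (mul_le_of_le_one_right (norm_nonneg _) (Finset.prod_le_one (fun _ _ => norm_nonneg _)
      fun _ _ => ContinuousLinearMap.norm_inl_le_one ℝ E X))

theorem eventually_forall_contDiffAt_prodMk_right {f : E × X → F} {n : ℕ} {θ₀ : E} {C : Set X}
    (hC : IsCompact C) (hf : ∀ x ∈ C, ContDiffAt ℝ n f (θ₀, x)) :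
    ∀ᶠ θ in 𝓝 θ₀, ∀ x ∈ C, ContDiffAt ℝ n f (θ, x) :=
  hC.eventually_forall_of_forall_eventually fun x hx => (hf x hx).eventually (by simp)

theorem exists_eventually_forall_norm_iteratedFDeriv_le {f : E × X → F} {k : ℕ} {θ₀ : E}
    {C : Set X} (hC : IsCompact C) (hf : ∀ x ∈ C, ContDiffAt ℝ k f (θ₀, x)) :
    ∃ M, ∀ᶠ θ in 𝓝 θ₀, ∀ x ∈ C, ‖iteratedFDeriv ℝ k (fun θ => f (θ, x)) θ‖ ≤ M := by
  have hcont (x : X) (hx : x ∈ C) : ContinuousAt (iteratedFDeriv ℝ k f) (θ₀, x) :=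
    ((hf x hx).iteratedFDeriv_right (m := 0) (i := k) (by rw [zero_add])).continuousAt
  obtain ⟨M, hM⟩ := hC.exists_bound_of_continuousOn (f := fun x => iteratedFDeriv ℝ k f (θ₀, x))
    fun x hx => ((hcont x hx).comp (f := fun x => (θ₀, x)) (by fun_prop)).continuousWithinAt
  have hbound : ∀ᶠ θ in 𝓝 θ₀, ∀ x ∈ C, ‖iteratedFDeriv ℝ k f (θ, x)‖ < M + 1 :=
    hC.eventually_forall_of_forall_eventually fun x hx =>
      (hcont x hx).norm.eventually_lt_const ((hM x hx).trans_lt (lt_add_one M))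
  refine ⟨M + 1, ?_⟩
  filter_upwards [hbound, eventually_forall_contDiffAt_prodMk_right hC hf] with θ hlt hsmooth x hx
  exact (norm_iteratedFDeriv_prodMk_right_le (hsmooth x hx)).trans (hlt x hx).le

end PartialDerivatives

section Gradient

variable {E : Type*} [NormedAddCommGroup E] [InnerProductSpace ℝ E] [CompleteSpace E]

theorem norm_gradient_eq_norm_iteratedFDeriv_one (f : E → ℝ) (θ : E) :
    ‖gradient f θ‖ = ‖iteratedFDeriv ℝ 1 f θ‖ := by
  rw [gradient, LinearIsometryEquiv.norm_map, norm_iteratedFDeriv_one]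

theorem continuousOn_gradient_prodMk_right {X : Type*} [NormedAddCommGroup X] [NormedSpace ℝ X]
    {f : E × X → ℝ} {θ₀ : E} {C : Set X} (hf : ∀ x ∈ C, ContDiffAt ℝ 1 f (θ₀, x)) :
    ContinuousOn (fun x => gradient (fun θ => f (θ, x)) θ₀) C := fun x hx => by
  have hswap : ContDiffAt ℝ 1 (Function.uncurry fun x θ => f (θ, x)) (x, θ₀) :=
    (hf x hx).comp (x, θ₀) (contDiffAt_snd.prodMk contDiffAt_fst)
  have hfderiv := (hswap.fderiv contDiffAt_const (m := 0) (by rw [zero_add])).continuousAt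
  exact ((InnerProductSpace.toDual ℝ E).symm.continuous.continuousAt.comp
    hfderiv).continuousWithinAt

end Gradient

theorem aestronglyMeasurable_of_forall_continuousOn {Y X F : Type*} [Countable Y]
    [MeasurableSpace Y] [MeasurableSingletonClass Y] [MeasurableSpace X] [TopologicalSpace X]
    [OpensMeasurableSpace X] [NormedAddCommGroup F] [MeasurableSpace F] [BorelSpace F]
    [SecondCountableTopology F] {P : Measure (Y × X)} {C : Set X} (hC : MeasurableSet C)
    (hP : ∀ᵐ z ∂P, z.2 ∈ C) {f : Y → X → F} (hf : ∀ y, ContinuousOn (f y) C) :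
    AEStronglyMeasurable (fun z => f z.1 z.2) P := by
  classical
  have hmeas : Measurable fun z : Y × X => C.indicator (f z.1) z.2 :=
    measurable_from_prod_countable_right fun y => by
      simp only [← Set.piecewise_eq_indicator]
      exact (hf y).measurable_piecewise continuousOn_const hC
  refine ⟨_, hmeas.stronglyMeasurable, ?_⟩
  filter_upwards [hP] with z hz
  rw [Set.indicator_of_mem hz]

variable {T K p q d : ℕ}

section RegularityConditions

variable {P : Measure (Observation T K p q)} [IsFiniteMeasure P] {θ₀ : EuclideanSpace ℝ (Fin d)}
  {C : Set (Regressors T K p q)}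

theorem scoreConditions_of_contDiffAt
    {F : (Fin T → Fin K) → EuclideanSpace ℝ (Fin d) × Regressors T K p q → ℝ}
    (hC : IsCompact C) (hP : ∀ᵐ z ∂P, z.2 ∈ C)
    (hF : ∀ y, ∀ x ∈ C, ContDiffAt ℝ 3 (F y) (θ₀, x)) :
    ScoreConditions P (fun z θ => F z.1 (θ, z.2)) θ₀ := by
  have hle (k : Fin 4) : (k : WithTop ℕ∞) ≤ 3 := by exact_mod_cast Nat.lt_succ_iff.1 k.2
  choose M hM using fun (y : Fin T → Fin K) (k : Fin 4) =>
    exists_eventually_forall_norm_iteratedFDeriv_le hC fun x hx => (hF y x hx).of_le (hle k)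
  obtain ⟨B, hB⟩ := (Set.finite_range fun i : (Fin T → Fin K) × Fin 4 => M i.1 i.2).bddAbove
  have hbound : ∀ᶠ θ in 𝓝 θ₀, ∀ y, ∀ x ∈ C, ∀ k ≤ 3,
      ‖iteratedFDeriv ℝ k (fun θ => F y (θ, x)) θ‖ ≤ B := by
    filter_upwards [Filter.eventually_all.2 fun y => Filter.eventually_all.2 (hM y)]
      with θ hθ y x hx k hk
    exact (hθ y ⟨k, Nat.lt_succ_of_le hk⟩ x hx).trans (hB ⟨(y, _), rfl⟩)
  have hsmooth : ∀ᶠ θ in 𝓝 θ₀, ∀ y, ∀ x ∈ C, ContDiffAt ℝ 3 (F y) (θ, x) :=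
    Filter.eventually_all.2 fun y => eventually_forall_contDiffAt_prodMk_right hC (hF y)
  obtain ⟨V, hV, hVopen, hθ₀⟩ := mem_nhds_iff.1 (hsmooth.and hbound)
  refine ⟨⟨V, hVopen, hθ₀, ?_, fun k hk => ⟨fun _ => B, integrable_const B, ?_⟩⟩, ?_⟩
  · filter_upwards [hP] with z hz θ hθ
    exact (((hV hθ).1 z.1 z.2 hz).comp (f := fun θ => (θ, z.2)) θ
      (contDiffAt_id.prodMk contDiffAt_const)).contDiffWithinAt
  · filter_upwards [hP] with z hz θ hθ
    exact (hV hθ).2 z.1 z.2 hz k hk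
  · refine MemLp.of_bound (aestronglyMeasurable_of_forall_continuousOn hC.measurableSet hP
      (f := fun y x => gradient (fun θ => F y (θ, x)) θ₀) fun y =>
        continuousOn_gradient_prodMk_right fun x hx => (hF y x hx).of_le (hle 1)) B ?_
    filter_upwards [hP] with z hz
    rw [norm_gradient_eq_norm_iteratedFDeriv_one]
    exact (hV hθ₀).2 z.1 z.2 hz 1 (by norm_num)

theorem scoreConditions_lcml
    {π : EuclideanSpace ℝ (Fin d) → (A : Finset (Fin T)) → (A → Fin K) → Regressors T K p q → ℝ}
    (hC : IsCompact C) (hP : ∀ᵐ z ∂P, z.2 ∈ C)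
    (hsmooth : ∀ x ∈ C, ∀ t t' : Fin T, t < t' → ∀ y : ({t, t'} : Finset (Fin T)) → Fin K,
      ContDiffAt ℝ 3 (fun a : EuclideanSpace ℝ (Fin d) × Regressors T K p q =>
        π a.1 {t, t'} y a.2) (θ₀, x))
    (hpos : ∀ x ∈ C, ∀ t t' : Fin T, t < t' → ∀ y : ({t, t'} : Finset (Fin T)) → Fin K,
      0 < π θ₀ {t, t'} y x) :
    ScoreConditions P (lcml π) θ₀ :=
  scoreConditions_of_contDiffAt (F := fun y a => ∑ t : Fin T, ∑ t' ∈ Finset.Ioi t,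
    Real.log (π a.1 {t, t'} (choicesOn {t, t'} y) a.2)) hC hP fun _ x hx =>
      ContDiffAt.sum fun t _ => ContDiffAt.sum fun t' ht' =>
        (hsmooth x hx t t' (Finset.mem_Ioi.1 ht') _).log
          (hpos x hx t t' (Finset.mem_Ioi.1 ht') _).ne'

end RegularityConditions

/-- The parametrisation is `n` times continuously differentiable at `θ₀`, and its values near `θ₀`
are covariance matrices, nonsingular ones for the errors: the local form of the assumptions on the
model. -/
structure RegularAt (m : Param K p q d) (n : WithTop ℕ∞) (θ₀ : EuclideanSpace ℝ (Fin d)) :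
    Prop where
  beta : ContDiffAt ℝ n m.beta θ₀
  Omega : ∀ i j, ContDiffAt ℝ n (fun θ => m.Omega θ i j) θ₀
  Sigma : ∀ i j, ContDiffAt ℝ n (fun θ => m.Sigma θ i j) θ₀
  posSemidef : ∀ᶠ θ in 𝓝 θ₀, (m.Omega θ).PosSemidef
  posDef : ∀ᶠ θ in 𝓝 θ₀, (m.Sigma θ).PosDef

namespace RegularAt

variable {m : Param K p q d} {n : WithTop ℕ∞} {θ₀ : EuclideanSpace ℝ (Fin d)}

theorem of_mem_interior {Θ : Set (EuclideanSpace ℝ (Fin d))} (hθ₀ : θ₀ ∈ interior Θ)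
    (hbeta : ContDiffOn ℝ n m.beta (interior Θ))
    (hOmega : ∀ i j, ContDiffOn ℝ n (fun θ => m.Omega θ i j) (interior Θ))
    (hSigma : ∀ i j, ContDiffOn ℝ n (fun θ => m.Sigma θ i j) (interior Θ))
    (hOmegaPSD : ∀ θ ∈ Θ, (m.Omega θ).PosSemidef) (hSigmaPD : ∀ θ ∈ Θ, (m.Sigma θ).PosDef) :
    RegularAt m n θ₀ where
  beta := hbeta.contDiffAt (isOpen_interior.mem_nhds hθ₀)
  Omega i j := (hOmega i j).contDiffAt (isOpen_interior.mem_nhds hθ₀)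
  Sigma i j := (hSigma i j).contDiffAt (isOpen_interior.mem_nhds hθ₀)
  posSemidef := Filter.mem_of_superset (mem_interior_iff_mem_nhds.1 hθ₀) hOmegaPSD
  posDef := Filter.mem_of_superset (mem_interior_iff_mem_nhds.1 hθ₀) hSigmaPD

variable (h : RegularAt m n θ₀) (A : Finset (Fin T)) (y : A → Fin K) (x : Regressors T K p q)

include h

theorem contDiffAt_diffLimit (i : DiffIdx A y) :
    ContDiffAt ℝ n (fun a : _ × Regressors T K p q => diffLimit m a.1 A y a.2 i) (θ₀, x) :=
  ContDiffAt.inner ℝ (by fun_prop) (h.beta.comp (θ₀, x) contDiffAt_fst)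

theorem contDiffAt_diffCov (i j : DiffIdx A y) :
    ContDiffAt ℝ n (fun a : _ × Regressors T K p q => diffCov m a.1 A y a.2 i j) (θ₀, x) := by
  have hOmega (i j) : ContDiffAt ℝ n (fun a : _ × Regressors T K p q => m.Omega a.1 i j) (θ₀, x) :=
    (h.Omega i j).comp (θ₀, x) contDiffAt_fst
  have hSigma (i j) : ContDiffAt ℝ n (fun a : _ × Regressors T K p q => m.Sigma a.1 i j) (θ₀, x) :=
    (h.Sigma i j).comp (θ₀, x) contDiffAt_fst
  have hloading (t : Fin T) (k l : Fin K) (r : Fin q) :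
      ContDiffAt ℝ n (fun a : EuclideanSpace ℝ (Fin d) × Regressors T K p q =>
        (a.2.2 t k - a.2.2 t l).ofLp r) (θ₀, x) := by fun_prop
  simp only [diffCov, Matrix.of_apply]
  refine (contDiffAt_dotProduct (hloading _ _ _) (contDiffAt_mulVec hOmega (hloading _ _ _))).add ?_
  split_ifs
  · exact (((hSigma _ _).sub (hSigma _ _)).sub (hSigma _ _)).add (hSigma _ _)
  · exact contDiffAt_const

theorem eventually_posSemidef_posDef :
    ∀ᶠ a : _ × Regressors T K p q in 𝓝 (θ₀, x),
      (m.Omega a.1).PosSemidef ∧ (m.Sigma a.1).PosDef :=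
  (continuous_fst.tendsto (θ₀, x)).eventually (h.posSemidef.and h.posDef)

theorem diffCov_self_pos (i : DiffIdx A y) : 0 < diffCov m θ₀ A y x i i :=
  (posDef_diffCov A y x h.posSemidef.self_of_nhds h.posDef.self_of_nhds).diag_pos

theorem contDiffAt_sqrt_diffCov (i : DiffIdx A y) :
    ContDiffAt ℝ n (fun a : _ × Regressors T K p q => √(diffCov m a.1 A y a.2 i i)) (θ₀, x) :=
  (h.contDiffAt_diffCov A y x i i).sqrt (h.diffCov_self_pos A y x i).ne'

theorem contDiffAt_limits (i : DiffIdx A y) :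
    ContDiffAt ℝ n (fun a : _ × Regressors T K p q => limits m a.1 A y a.2 i) (θ₀, x) :=
  (h.contDiffAt_diffLimit A y x i).div (h.contDiffAt_sqrt_diffCov A y x i)
    (Real.sqrt_pos.2 (h.diffCov_self_pos A y x i)).ne'

theorem contDiffAt_corr (i j : DiffIdx A y) :
    ContDiffAt ℝ n (fun a : _ × Regressors T K p q => corr m a.1 A y a.2 i j) (θ₀, x) :=
  (h.contDiffAt_diffCov A y x i j).div
    ((h.contDiffAt_sqrt_diffCov A y x i).mul (h.contDiffAt_sqrt_diffCov A y x j))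
    (mul_pos (Real.sqrt_pos.2 (h.diffCov_self_pos A y x i))
      (Real.sqrt_pos.2 (h.diffCov_self_pos A y x j))).ne'

theorem contDiffAt_mnpProb :
    ContDiffAt ℝ n (fun a : _ × Regressors T K p q => mnpProb m a.1 A y a.2) (θ₀, x) := by
  have hadm := h.eventually_posSemidef_posDef x
  exact (contDiffAt_multivariateGaussian_real (h.contDiffAt_diffCov A y x)
    (h.contDiffAt_diffLimit A y x) (hadm.mono fun a ha => posDef_diffCov A y a.2 ha.1 ha.2)
    Set.univ).congr_of_eventuallyEq
      (hadm.mono fun a ha => mnpProb_eq_multivariateGaussian A y a.2 ha.1 ha.2)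

variable (o : Orderings T K)

theorem contDiffAt_sjProb :
    ContDiffAt ℝ n (fun a : _ × Regressors T K p q => sjProb m o a.1 A y a.2) (θ₀, x) :=
  (ContDiffAt.sum fun σ _ => contDiffAt_sjCDF (fun _ _ => h.contDiffAt_corr A y x _ _)
    (fun _ => h.contDiffAt_limits A y x _)
    ((h.eventually_posSemidef_posDef x).mono fun a ha =>
      (posDef_corr A y a.2 ha.1 ha.2).submatrix σ.injective)).div_const _

theorem contDiffAt_sjProbNormalized (hsum : ∑ y' : A → Fin K, sjProb m o θ₀ A y' x ≠ 0) :
    ContDiffAt ℝ n (fun a : _ × Regressors T K p q => sjProbNormalized m o a.1 A y a.2) (θ₀, x) :=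
  (h.contDiffAt_sjProb A y x o).div
    (ContDiffAt.sum fun y' _ => h.contDiffAt_sjProb A y' x o) hsum

end RegularAt

theorem isCompact_bounded_regressors (M M' : ℝ) :
    IsCompact {x : Regressors T K p q | ∀ t k, ‖x.1 t k‖ ≤ M ∧ ‖x.2 t k‖ ≤ M'} := by
  convert (isCompact_univ_pi fun _ : Fin T => isCompact_univ_pi fun _ : Fin K =>
    isCompact_closedBall (0 : EuclideanSpace ℝ (Fin p)) M).prod
      (isCompact_univ_pi fun _ : Fin T => isCompact_univ_pi fun _ : Fin K =>
        isCompact_closedBall (0 : EuclideanSpace ℝ (Fin q)) M') using 1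
  ext x
  simp [Set.mem_prod, forall_and]

end PanelProbit

open PanelProbit in
theorem theorem2_general {T K p q d : ℕ} {m : Param K p q d} {θ₀ : EuclideanSpace ℝ (Fin d)}
    (h : RegularAt m 3 θ₀) {P : Measure (Observation T K p q)} [IsFiniteMeasure P] {MX MX' : ℝ}
    (hX : ∀ᵐ z ∂P, ∀ t k, ‖z.2.1 t k‖ ≤ MX ∧ ‖z.2.2 t k‖ ≤ MX') :
    ScoreConditions P (lcml (mnpProb m)) θ₀ ∧
    ∀ o : Orderings T K,
      (∀ x ∈ (P.map Prod.snd).support, ∀ t t' : Fin T, t < t' →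
        ∀ y : ({t, t'} : Finset (Fin T)) → Fin K, 0 < sjProb m o θ₀ {t, t'} y x) →
      ScoreConditions P (lcml (sjProb m o)) θ₀ ∧
      ScoreConditions P (lcml (sjProbNormalized m o)) θ₀ := by
  have hC := isCompact_bounded_regressors (T := T) (K := K) (p := p) (q := q) MX MX'
  refine ⟨scoreConditions_lcml hC hX (fun x _ t t' _ y => h.contDiffAt_mnpProb {t, t'} y x)
    fun x _ t t' _ y =>
      mnpProb_pos {t, t'} y x h.posSemidef.self_of_nhds h.posDef.self_of_nhds, fun o hpos => ?_⟩
  have hCs := hC.inter_right (Measure.isClosed_support (μ := P.map Prod.snd))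
  have hXs := hX.and (ae_of_ae_map measurable_snd.aemeasurable Measure.support_mem_ae)
  have hsum (x) (hx : x ∈ (P.map Prod.snd).support) (t t' : Fin T) (ht : t < t')
      (y : ({t, t'} : Finset (Fin T)) → Fin K) : 0 < ∑ y', sjProb m o θ₀ {t, t'} y' x :=
    Finset.sum_pos (fun y' _ => hpos x hx t t' ht y') ⟨y, Finset.mem_univ y⟩
  exact ⟨scoreConditions_lcml hCs hXs (fun x _ t t' _ y => h.contDiffAt_sjProb {t, t'} y x o)
      fun x hx => hpos x hx.2,
    scoreConditions_lcml hCs hXs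
      (fun x hx t t' ht y =>
        h.contDiffAt_sjProbNormalized {t, t'} y x o (hsum x hx.2 t t' ht y).ne')
      fun x hx t t' ht y => div_pos (hpos x hx.2 t t' ht y) (hsum x hx.2 t t' ht y)⟩

open scoped Matrix.Norms.L2Operator in
theorem theorem2 {T K p q d : ℕ} (m : PanelProbit.Param K p q d)
    (Θ : Set (EuclideanSpace ℝ (Fin d))) (hΘ : IsCompact Θ)
    -- the parametrisation
    (hbeta : ContDiffOn ℝ 3 m.beta (interior Θ))
    (hOmega : ∀ i j, ContDiffOn ℝ 3 (fun θ => m.Omega θ i j) (interior Θ))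
    (hSigma : ∀ i j, ContDiffOn ℝ 3 (fun θ => m.Sigma θ i j) (interior Θ))
    (hOmegaPSD : ∀ θ ∈ Θ, (m.Omega θ).PosSemidef)
    (hSigmaPD : ∀ θ ∈ Θ, (m.Sigma θ).PosDef)
    (MSigma : ℝ) (hSigmaInv : ∀ θ ∈ Θ, ‖(m.Sigma θ)⁻¹‖ ≤ MSigma)
    -- the true parameter
    (θ₀ : EuclideanSpace ℝ (Fin d)) (hθ₀ : θ₀ ∈ interior Θ)
    -- the law of the data, with bounded regressors
    (P : MeasureTheory.Measure (PanelProbit.Observation T K p q))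
    [MeasureTheory.IsProbabilityMeasure P] (MX MX' : ℝ)
    (hX : ∀ᵐ z ∂P, ∀ t k, ‖z.2.1 t k‖ ≤ MX ∧ ‖z.2.2 t k‖ ≤ MX') :
    (PanelProbit.GeneratedByMNP m θ₀ P →
      PanelProbit.ScoreConditions P (PanelProbit.lcml (PanelProbit.mnpProb m)) θ₀) ∧
    ∀ o : PanelProbit.Orderings T K, PanelProbit.GeneratedBySJ m o θ₀ P →
      -- the approximated probabilities of all pairs of choices are positive at `θ₀`
      (∀ x ∈ (P.map Prod.snd).support, ∀ t t' : Fin T, t < t' →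
        ∀ y : ({t, t'} : Finset (Fin T)) → Fin K,
          0 < PanelProbit.sjProb m o θ₀ {t, t'} y x) →
      PanelProbit.ScoreConditions P (PanelProbit.lcml (PanelProbit.sjProb m o)) θ₀ ∧
      PanelProbit.ScoreConditions P (PanelProbit.lcml (PanelProbit.sjProbNormalized m o)) θ₀ := by
  have h := theorem2_general (.of_mem_interior hθ₀ hbeta hOmega hSigma hOmegaPSD hSigmaPD) hX
  exact ⟨fun _ => h.1, fun o _ => h.2 o⟩
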